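/- Let $J$ be the James space: the space of all real sequences $x=(x_n)_{n\ge 0}$ with $\lim_n x_n=0$ and $$\|x\|_J=\frac1{\sqrt2}\,\sup\Big[(x_{p_1}-x_{p_2})^2+(x_{p_2}-x_{p_3})^2+\cdots+(x_{p_{m-1}}-x_{p_m})^2+(x_{p_m}-x_{p_1})^2\Big]^{1/2}<\infty,$$ where the supremum is over all $m\ge1$ and all indices $p_1<p_2<\cdots<p_m$. Let $e_i$ be the sequence whose $i$-th term is $1$ and whose other terms are $0$, and let $J_K$ be the linear span of $e_0,\dots,e_K$, with the norm of $J$. For a basis $(c_i)$ of a finite-dimensional normed space $X$, its unconditional constant is $$\sup\ \frac{\big\|\sum_i\epsilon_i\alpha_i c_i\big\|}{\big\|\sum_i\alpha_i c_i\big\|},$$ the supremum being over all signs $\epsilon_i\in\{-1,1\}$ and all real coefficients $(\alpha_i)$, not all zero. A normed space $X$ has local unconditional structure if there is a constant $B$ such that every finitely generated linear subspace of $X$ has a basis with unconditional constant at most $B$. Define functions $f_m:\mathbb N\to\mathbb N$ by $f_0(n)=n+1$ and $f_{m+1}(n)=f_m^{\,n}(n)$ (the function $f_m$ applied $n$ times,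 starting at $n$), and put $f_\omega(m)=f_m(m)$. **Theorem.** Let $B$ be a real number and $K$ a natural number with $K\ge f_\omega\big(\lceil 2^{29}B^4+5\rceil\big)$. Then every basis of $J_K$ has unconditional constant strictly greater than $B$. In particular, $J$ does not have local unconditional structure. -/

import Mathlib

noncomputable section

/-- The fast-growing hierarchy at finite levels: `f₀ n = n + 1` and `f_{m+1} n = f_m^n n`
(the `n`-fold iterate of `f_m`, applied to `n`). -/
def fastGrowing : ℕ → ℕ → ℕ
  | 0 => fun n => n + 1
  | m + 1 => fun n => (fastGrowing m)^[n] n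

/-- The diagonal level `f_ω m = f_m m`. -/
def fastGrowingOmega (m : ℕ) : ℕ := fastGrowing m m

namespace James

/-- The nonempty finite increasing sequences `p₀ < p₁ < ⋯ < p_m` of indices. -/
abbrev Chain : Type := Σ m : ℕ, {p : Fin (m + 1) → ℕ // StrictMono p}

/-- The vector of cyclic differences `(α p₀ - α p₁, …, α p_{m-1} - α p_m, α p_m - α p₀)`;
the addition `i + 1` in `Fin (m + 1)` wraps around. -/
def cyclicDiff (c : Chain) (α : ℕ → ℝ) : EuclideanSpace ℝ (Fin (c.1 + 1)) :=
  WithLp.toLp 2 fun i => α (c.2.1 i) - α (c.2.1 (i + 1))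

/-- The cyclic quadratic variation
`[(α p₀ - α p₁)² + ⋯ + (α p_{m-1} - α p_m)² + (α p_m - α p₀)²]^{1/2}`. -/
def variation (c : Chain) (α : ℕ → ℝ) : ℝ :=
  √(∑ i : Fin (c.1 + 1), (α (c.2.1 i) - α (c.2.1 (i + 1))) ^ 2)

theorem variation_eq_norm (c : Chain) (α : ℕ → ℝ) : variation c α = ‖cyclicDiff c α‖ := by
  simp [variation, cyclicDiff, EuclideanSpace.norm_eq]

theorem variation_nonneg (c : Chain) (α : ℕ → ℝ) : 0 ≤ variation c α := Real.sqrt_nonneg _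

theorem variation_zero (c : Chain) : variation c 0 = 0 := by simp [variation]

theorem variation_add_le (c : Chain) (α β : ℕ → ℝ) :
    variation c (α + β) ≤ variation c α + variation c β := by
  simp only [variation_eq_norm]
  have h : cyclicDiff c (α + β) = cyclicDiff c α + cyclicDiff c β := by
    ext i; simp [cyclicDiff]; ring
  rw [h]; exact norm_add_le _ _

theorem variation_smul (c : Chain) (r : ℝ) (α : ℕ → ℝ) :
    variation c (r • α) = |r| * variation c α := by
  simp only [variation_eq_norm]
  have h : cyclicDiff c (r • α) = r • cyclicDiff c α := by
    ext i; simp [cyclicDiff]; ring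
  rw [h, norm_smul, Real.norm_eq_abs]

/-- The James space as a vector space of real sequences: those null sequences for which the
cyclic quadratic variations over all finite increasing sequences of indices are bounded. -/
def jamesSubmodule : Submodule ℝ (ℕ → ℝ) where
  carrier := {α | BddAbove (Set.range fun c : Chain => variation c α) ∧
    Filter.Tendsto α Filter.atTop (nhds 0)}
  zero_mem' := ⟨⟨0, by rintro _ ⟨c, rfl⟩; exact (variation_zero c).le⟩, tendsto_const_nhds⟩
  add_mem' := by
    rintro α β ⟨⟨a, ha⟩, hα⟩ ⟨⟨b, hb⟩, hβ⟩
    refine ⟨⟨a + b, ?_⟩, ?_⟩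
    · rintro _ ⟨c, rfl⟩
      exact (variation_add_le c α β).trans (add_le_add (ha ⟨c, rfl⟩) (hb ⟨c, rfl⟩))
    · have h := Filter.Tendsto.add hα hβ
      rw [add_zero] at h
      exact h
  smul_mem' := by
    rintro r α ⟨⟨a, ha⟩, hα⟩
    refine ⟨⟨|r| * a, ?_⟩, ?_⟩
    · rintro _ ⟨c, rfl⟩
      have h : variation c α ≤ a := ha ⟨c, rfl⟩
      simp only [variation_smul]
      gcongr
    · have h := Filter.Tendsto.const_smul hα r
      rw [smul_zero] at h
      exact h

end James

/-- The James space `J`. It is a type of its own, so that it carries only the topology of the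
James norm, not that of pointwise convergence. -/
def JamesSpace : Type := ↥James.jamesSubmodule

namespace JamesSpace

open James

instance : AddCommGroup JamesSpace := inferInstanceAs (AddCommGroup ↥jamesSubmodule)

instance : Module ℝ JamesSpace := inferInstanceAs (Module ℝ ↥jamesSubmodule)

/-- The sequence of coordinates of an element of `J`. -/
def coord (x : JamesSpace) : ℕ → ℝ := x.1

theorem coord_add (x y : JamesSpace) : (x + y).coord = x.coord + y.coord := rfl

theorem coord_smul (r : ℝ) (x : JamesSpace) : (r • x).coord = r • x.coord := rfl

theorem coord_zero : (0 : JamesSpace).coord = 0 := rfl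

theorem bddAbove (x : JamesSpace) : BddAbove (Set.range fun c : Chain => variation c x.coord) :=
  x.2.1

instance : Nonempty Chain := ⟨⟨0, fun i => i, fun _ _ h => h⟩⟩

/-- The James norm: `1/√2` times the supremum of the cyclic quadratic variations. -/
instance : Norm JamesSpace := ⟨fun x => 1 / √2 * ⨆ c : Chain, variation c x.coord⟩

theorem norm_def (x : JamesSpace) : ‖x‖ = 1 / √2 * ⨆ c : Chain, variation c x.coord := rfl

theorem eq_zero_of_norm_eq_zero (x : JamesSpace) (hx : ‖x‖ = 0) : x = 0 := by
  have hs : (⨆ c : Chain, variation c x.coord) = 0 := by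
    rw [norm_def] at hx
    exact (mul_eq_zero.1 hx).resolve_left (by positivity)
  have hv : ∀ c : Chain, variation c x.coord = 0 := fun c =>
    le_antisymm (hs ▸ le_ciSup x.bddAbove c) (variation_nonneg _ _)
  have hlt : ∀ a b : ℕ, a < b → x.coord a = x.coord b := by
    intro a b hab
    have hmono : StrictMono (![a, b] : Fin 2 → ℕ) := by
      intro i j hij
      fin_cases i <;> fin_cases j <;> simp_all
    have h := hv ⟨1, ![a, b], hmono⟩
    rw [variation_eq_norm, norm_eq_zero] at h
    have h0 := congrArg (fun v => v 0) h
    simp [cyclicDiff] at h0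
    linarith
  have hconst : ∀ n, x.coord n = x.coord 0 := by
    intro n
    rcases Nat.eq_zero_or_pos n with rfl | hn
    · rfl
    · exact (hlt 0 n hn).symm
  have hlim : Filter.Tendsto x.coord Filter.atTop (nhds 0) := x.2.2
  have h0 : x.coord 0 = 0 := by
    have : x.coord = fun _ => x.coord 0 := funext hconst
    rw [this] at hlim
    exact tendsto_nhds_unique tendsto_const_nhds hlim
  exact Subtype.ext (funext fun n => (hconst n).trans h0)

theorem normCore : NormedSpace.Core ℝ JamesSpace where
  norm_nonneg x := mul_nonneg (by positivity) (Real.iSup_nonneg fun c => variation_nonneg _ _)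
  norm_smul r x := by
    simp only [norm_def, coord_smul, variation_smul, Real.norm_eq_abs]
    rw [← Real.mul_iSup_of_nonneg (abs_nonneg r)]
    ring
  norm_triangle x y := by
    simp only [norm_def, ← mul_add]
    refine mul_le_mul_of_nonneg_left (ciSup_le fun c => ?_) (by positivity)
    exact (variation_add_le c _ _).trans
      (add_le_add (le_ciSup x.bddAbove c) (le_ciSup y.bddAbove c))
  norm_eq_zero_iff x := by
    refine ⟨eq_zero_of_norm_eq_zero x, ?_⟩
    rintro rfl
    simp [norm_def, coord_zero, variation_zero]

instance : NormedAddCommGroup JamesSpace := NormedAddCommGroup.ofCore normCore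

instance : NormedSpace ℝ JamesSpace := NormedSpace.ofCore normCore

theorem single_mem (i : ℕ) : (Pi.single i 1 : ℕ → ℝ) ∈ jamesSubmodule := by
  refine ⟨⟨2, ?_⟩, ?_⟩
  · rintro _ ⟨⟨m, p, hp⟩, rfl⟩
    refine Real.sqrt_le_iff.2 ⟨by norm_num, ?_⟩
    set a : ℕ → ℝ := Pi.single i 1 with ha
    have h1 : ∑ j : Fin (m + 1), a (p j) ^ 2 ≤ 1 := by
      by_cases h : ∃ j, p j = i
      · obtain ⟨j, hj⟩ := h
        rw [Finset.sum_eq_single j]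
        · simp [ha, hj]
        · intro k _ hk
          have : p k ≠ i := fun h => hk (hp.injective (h.trans hj.symm))
          simp [ha, this]
        · simp
      · push Not at h
        simp [ha, h]
    have h2 : ∑ j : Fin (m + 1), a (p (j + 1)) ^ 2 = ∑ j : Fin (m + 1), a (p j) ^ 2 :=
      Equiv.sum_comp (Equiv.addRight (1 : Fin (m + 1))) fun j => a (p j) ^ 2
    calc ∑ j : Fin (m + 1), (a (p j) - a (p (j + 1))) ^ 2
        ≤ ∑ j : Fin (m + 1), (2 * a (p j) ^ 2 + 2 * a (p (j + 1)) ^ 2) :=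
          Finset.sum_le_sum fun j _ => by nlinarith [sq_nonneg (a (p j) + a (p (j + 1)))]
      _ ≤ 2 ^ 2 := by
          rw [Finset.sum_add_distrib, ← Finset.mul_sum, ← Finset.mul_sum, h2]
          linarith
  · refine tendsto_const_nhds.congr' ?_
    filter_upwards [Filter.eventually_gt_atTop i] with n hn
    simp [hn.ne']

/-- The canonical basis vector `e_i = (0, …, 0, 1, 0, …)`, with the `1` in position `i`. -/
def e (i : ℕ) : JamesSpace := ⟨Pi.single i 1, single_mem i⟩

/-- The subspace `J_K` of `J` spanned by `e_0, …, e_K`, with the norm of `J`. -/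
def initial (K : ℕ) : Submodule ℝ JamesSpace := Submodule.span ℝ (e '' Set.Iic K)

end JamesSpace

/-- The unconditional constant of a finite basis `(c_i)`: the supremum of
`‖∑ i, ε i * α i • c i‖ / ‖∑ i, α i • c i‖` over all signs `ε i ∈ {-1, 1}` and all coefficients
`α`. (The zero vector contributes `0 / 0 = 0`, which does not affect the supremum on a
nonzero space.) -/
def unconditionalConstant {ι X : Type*} [Fintype ι] [NormedAddCommGroup X] [NormedSpace ℝ X]
    (c : Module.Basis ι ℝ X) : EReal :=
  ⨆ (ε : ι → ℝ) (_ : ∀ i, ε i = 1 ∨ ε i = -1) (α : ι → ℝ),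
    ((‖∑ i, (ε i * α i) • c i‖ / ‖∑ i, α i • c i‖ : ℝ) : EReal)

/-- `X` has local unconditional structure: for some constant `B`, every finitely generated
subspace of `X` has a basis whose unconditional constant is at most `B`. -/
def HasLocalUnconditionalStructure (X : Type*) [NormedAddCommGroup X] [NormedSpace ℝ X] : Prop :=
  ∃ B : ℝ, ∀ V : Submodule ℝ X, V.FG →
    ∃ (n : ℕ) (c : Module.Basis (Fin n) ℝ V), unconditionalConstant c ≤ (B : EReal)

end

/-!
# Every basis of a long initial segment of the James space has a large unconditional constant

Suppose that `J_K` has a basis `(c_i)` with unconditional constant at most `B`. Write the partial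
sums `s_n = e_0 + ⋯ + e_n` in this basis, `f_n i = c_i^*(s_n)`, and evaluate the coordinate
functionals on it, `g_n i = e_n^*(c_i)`. Then `∑ i, f_n i * g_j i` is `1` for `j ≤ n` and `0`
otherwise, while unconditionality gives `∑ i, |x i| * |y i| ≤ B ‖x‖ ‖y‖` for the coordinates of
a vector and of a functional. The only other property of the James norm that enters is that a
signed sum of `q` differences of the `s_n`, or of the `e_n^*`, over disjoint intervals of indices
has norm of order `√q`. Choosing signs well (`exists_signs`), one gets the same order for the
weighted `ℓ¹`-norm of the pointwise maximum of such differences. These are the properties of a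
*tame* sequence (`IsTame`, `JamesSpace.isTame_coordPair`); it consists of the pairs `(f_n, g_n)`,
regarded as functions on two copies of the index set, so that every estimate for vectors is also
one for functionals.

The contradiction is a finite form of the argument that, in infinite dimensions, the `f_n` would
converge weakly in every weighted `ℓ¹`-space with weight `|g_j|`, and conversely, so that the two
iterated limits of the biorthogonality relations would agree. In `ℓ¹` with a fixed weight, the
estimate for maxima makes the sequence order bounded up to a small error (`exists_truncation`). After truncation it lives in a Hilbert space, where among sufficiently many
vectors there are block convex combinations that nearly coincide (`exists_blocks_energy_le`,
`exists_blocks_close`). Iterating this with the weights given by the terms already chosen produces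
a *stable* sequence `y_0, …, y_m` of pairs: with respect to the weight from `y_r`, all later terms
nearly coincide (`IsTame.exists_stable`). A stable sequence is incompatible with the
biorthogonality relations (`IsTame.false_of_stable`), because for suitable `r` the pairings of
`y_r` with the last term in the two orders nearly agree, although one of them is `0` and the other
is `1`.

The number of terms needed is of the form `p ↦ p ^ R` iterated `m` times, with `R` and `m`
polynomial in `B`, hence doubly exponential in a polynomial of `B`
(`stageLength_le_fastGrowingOmega`); this is far below the fast-growing bound of the theorem.
-/

/-! ### Weighted `ℓ¹` estimates on convex hulls -/

theorem sum_mul_abs_sub_le_of_mem_convexHull {κ E : Type*} [Fintype κ] [AddCommGroup E]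
    [Module ℝ E] {S : Set E} {w : κ → ℝ} (hw : ∀ i, 0 ≤ w i) (ψ : E →ₗ[ℝ] κ → ℝ) (a : κ → ℝ)
    {C : ℝ} (h : ∀ v ∈ S, ∑ i, w i * |ψ v i - a i| ≤ C) {v : E} (hv : v ∈ convexHull ℝ S) :
    ∑ i, w i * |ψ v i - a i| ≤ C := by
  have hc : Convex ℝ {v : E | ∑ i, w i * |ψ v i - a i| ≤ C} := by
    intro u hu v hv s t hs ht hst
    simp only [Set.mem_ofPred_eq] at hu hv ⊢
    calc ∑ i, w i * |ψ (s • u + t • v) i - a i|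
        ≤ ∑ i, (s * (w i * |ψ u i - a i|) + t * (w i * |ψ v i - a i|)) := by
          refine Finset.sum_le_sum fun i _ => ?_
          have h1 : ψ (s • u + t • v) i - a i = s * (ψ u i - a i) + t * (ψ v i - a i) := by
            simp only [map_add, map_smul, Pi.add_apply, Pi.smul_apply, smul_eq_mul]
            linear_combination a i * hst
          have h2 : |ψ (s • u + t • v) i - a i| ≤ s * |ψ u i - a i| + t * |ψ v i - a i| := by
            rw [h1]
            refine (abs_add_le _ _).trans_eq ?_
            rw [abs_mul, abs_mul, abs_of_nonneg hs, abs_of_nonneg ht]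
          calc _ ≤ w i * (s * |ψ u i - a i| + t * |ψ v i - a i|) :=
                mul_le_mul_of_nonneg_left h2 (hw i)
            _ = _ := by ring
      _ = s * ∑ i, w i * |ψ u i - a i| + t * ∑ i, w i * |ψ v i - a i| := by
          rw [Finset.sum_add_distrib, Finset.mul_sum, Finset.mul_sum]
      _ ≤ s * C + t * C := by gcongr
      _ = C := by rw [← add_mul, hst, one_mul]
  exact convexHull_min h hc hv

theorem sum_mul_abs_le_of_mem_convexHull {κ : Type*} [Fintype κ] {S : Set (κ → ℝ)} {w : κ → ℝ}
    (hw : ∀ i, 0 ≤ w i) {C : ℝ} (h : ∀ v ∈ S, ∑ i, w i * |v i| ≤ C) {v : κ → ℝ}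
    (hv : v ∈ convexHull ℝ S) : ∑ i, w i * |v i| ≤ C := by
  have := sum_mul_abs_sub_le_of_mem_convexHull hw LinearMap.id 0 (C := C) (S := S)
    (by simpa using h) hv
  simpa using this

theorem sum_mul_abs_sub_le_of_mem_convexHull₂ {κ : Type*} [Fintype κ] {S T : Set (κ → ℝ)}
    {w : κ → ℝ} (hw : ∀ i, 0 ≤ w i) {C : ℝ}
    (h : ∀ u ∈ S, ∀ v ∈ T, ∑ i, w i * |u i - v i| ≤ C) {u v : κ → ℝ}
    (hu : u ∈ convexHull ℝ S) (hv : v ∈ convexHull ℝ T) : ∑ i, w i * |u i - v i| ≤ C := by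
  refine sum_mul_abs_sub_le_of_mem_convexHull hw LinearMap.id v (fun a ha => ?_) hu
  have := sum_mul_abs_sub_le_of_mem_convexHull hw LinearMap.id a (C := C) (S := T)
    (fun b hb => by simpa [abs_sub_comm] using h a ha b hb) hv
  simpa [abs_sub_comm] using this

/-- A sequence `x 0, …, x (N - 1)` of functions on two copies of `ι`, thought of as pairs of a
vector and a functional written in coordinates. Weighted by the swapped absolute value of any
term, the terms are bounded in `ℓ¹`, and the pointwise maximum of `q` differences over disjoint
intervals of indices has `ℓ¹`-norm of order `√q` only. The maximum is encoded by a selector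
`σ`. -/
structure IsTame {ι : Type*} [Fintype ι] (D : ℝ) (N : ℕ) (x : ℕ → ι ⊕ ι → ℝ) : Prop where
  sum_le : ∀ j < N, ∀ k < N, ∑ i, |x j i.swap| * |x k i| ≤ D
  sum_diff_le : ∀ j < N, ∀ (q : ℕ) (ν : ℕ → ℕ), (∀ k < 2 * q, ν k < N) →
    (∀ k l, k < l → l < 2 * q → ν k < ν l) → ∀ σ : ι ⊕ ι → ℕ, (∀ i, σ i < q) →
      ∑ i, |x j i.swap| * |x (ν (2 * σ i + 1)) i - x (ν (2 * σ i)) i| ≤ D * √q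

theorem sum_swap_mul {ι : Type*} [Fintype ι] (a b : ι ⊕ ι → ℝ) :
    ∑ i, |a i.swap| * |b i| = ∑ i, |b i.swap| * |a i| := by
  simp only [Fintype.sum_sum_type, Sum.swap_inl, Sum.swap_inr]
  rw [add_comm]
  simp only [mul_comm]

theorem sum_swap_mul_le_of_mem_convexHull {ι : Type*} [Fintype ι] {S : Set (ι ⊕ ι → ℝ)}
    {b : ι ⊕ ι → ℝ} {C : ℝ} (h : ∀ v ∈ S, ∑ i, |v i.swap| * |b i| ≤ C) {v : ι ⊕ ι → ℝ}
    (hv : v ∈ convexHull ℝ S) : ∑ i, |v i.swap| * |b i| ≤ C := by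
  rw [sum_swap_mul]
  refine sum_mul_abs_le_of_mem_convexHull (fun i => abs_nonneg _) (fun u hu => ?_) hv
  rw [sum_swap_mul]
  exact h u hu

/-- Block convex combinations of a tame sequence are tame. -/
theorem IsTame.of_convexHull {ι : Type*} [Fintype ι] {D : ℝ} {N p : ℕ} {x v : ℕ → ι ⊕ ι → ℝ}
    (hx : IsTame D N x) {J : ℕ → Set ℕ} (hJN : ∀ l < p, ∀ a ∈ J l, a < N)
    (hJ : ∀ k l, k < l → l < p → ∀ a ∈ J k, ∀ b ∈ J l, a < b)
    (hv : ∀ l < p, v l ∈ convexHull ℝ (x '' J l)) : IsTame D p v := by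
  constructor
  · intro j hj k hk
    refine sum_swap_mul_le_of_mem_convexHull ?_ (hv j hj)
    rintro _ ⟨a, ha, rfl⟩
    refine sum_mul_abs_le_of_mem_convexHull (fun i => abs_nonneg _) ?_ (hv k hk)
    rintro _ ⟨b, hb, rfl⟩
    exact hx.sum_le a (hJN j hj a ha) b (hJN k hk b hb)
  · intro j hj q ν hν hmono σ hσ
    refine sum_swap_mul_le_of_mem_convexHull
      (b := fun i => v (ν (2 * σ i + 1)) i - v (ν (2 * σ i)) i) ?_ (hv j hj)
    rintro _ ⟨a, ha, rfl⟩
    have h0 : ∀ i, 2 * σ i < 2 * q := fun i => by have := hσ i; omega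
    have h1 : ∀ i, 2 * σ i + 1 < 2 * q := fun i => by have := hσ i; omega
    let ψ : (Fin (2 * q) → ι ⊕ ι → ℝ) →ₗ[ℝ] ι ⊕ ι → ℝ :=
      { toFun := fun u i => u ⟨2 * σ i + 1, h1 i⟩ i - u ⟨2 * σ i, h0 i⟩ i
        map_add' := fun u u' => by ext i; simp; ring
        map_smul' := fun r u => by ext i; simp; ring }
    have hmem : (fun k : Fin (2 * q) => v (ν k)) ∈
        convexHull ℝ (Set.univ.pi fun k : Fin (2 * q) => x '' J (ν k)) :=
      mem_convexHull_pi fun k _ => hv _ (hν k k.2)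
    have := sum_mul_abs_sub_le_of_mem_convexHull (w := fun i => |x a i.swap|)
      (fun i => abs_nonneg _) ψ 0 (C := D * √q) ?_ hmem
    · simpa [ψ] using this
    · intro u hu
      simp only [Set.mem_pi, Set.mem_univ, true_implies, Set.mem_image] at hu
      choose μ hμ hxμ using hu
      have := hx.sum_diff_le a (hJN j hj a ha) q
        (fun k => if hk : k < 2 * q then μ ⟨k, hk⟩ else 0)
        (fun k hk => by simpa [hk] using hJN _ (hν k hk) _ (hμ ⟨k, hk⟩))
        (fun k l hkl hl => by
          simp only [hl, hkl.trans hl, dif_pos]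
          exact hJ _ _ (hmono k l hkl hl) (hν l hl) _ (hμ ⟨k, hkl.trans hl⟩) _ (hμ ⟨l, hl⟩)) σ hσ
      simpa [ψ, h0, h1, hxμ] using this

/-! ### Truncation -/

/-- If the maximum of `q` differences has weighted `ℓ¹`-norm of order `√q`, then the sequence is
dominated up to `ε` by one function `h`. It is the pointwise maximum over a set `A` of indices
that maximizes the weighted norm of this maximum minus `ε` times the cardinality: each member of
such a set exceeds all the others by at least `ε` on a part of its own, and these parts are
disjoint, so that `A` cannot be large. -/
theorem exists_truncation {κ : Type*} [Fintype κ] {w : κ → ℝ} (hw : ∀ i, 0 ≤ w i)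
    {x : ℕ → κ → ℝ} {N : ℕ} {D : ℝ} (hD : 0 ≤ D) (hb : ∀ k < N, ∑ i, w i * |x k i| ≤ D)
    (hM : ∀ (q : ℕ) (ν : ℕ → ℕ), (∀ k < 2 * q, ν k < N) →
      (∀ k l, k < l → l < 2 * q → ν k < ν l) → ∀ σ : κ → ℕ, (∀ i, σ i < q) →
        ∑ i, w i * |x (ν (2 * σ i + 1)) i - x (ν (2 * σ i)) i| ≤ D * √q)
    {ε : ℝ} (hε : 0 < ε) :
    ∃ h : κ → ℝ, (∀ i, 0 ≤ h i) ∧ ∑ i, w i * h i ≤ (2 * (D / ε) ^ 2 + 1) * D ∧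
      ∀ k < N, ∑ i, w i * max (|x k i| - h i) 0 ≤ ε := by
  classical
  set H : Finset ℕ → κ → ℝ := fun A i => ((A.sup fun k => ‖x k i‖₊ : NNReal) : ℝ) with hH
  have hle : ∀ (A : Finset ℕ) (i : κ), ∀ k ∈ A, |x k i| ≤ H A i := by
    intro A i k hk
    have := Finset.le_sup (f := fun k => ‖x k i‖₊) hk
    exact_mod_cast this
  have hins : ∀ (A : Finset ℕ) (k : ℕ) (i : κ), H (insert k A) i = max |x k i| (H A i) := by
    intro A k i
    simp [hH, Finset.sup_insert, Real.norm_eq_abs]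
  have hnn : ∀ A i, 0 ≤ H A i := fun A i => NNReal.coe_nonneg _
  obtain ⟨A, hA, hmax⟩ := Finset.exists_max_image (Finset.range N).powerset
    (fun A => ∑ i, w i * H A i - ε * A.card) ⟨∅, by simp⟩
  have hAN : ∀ k ∈ A, k < N := fun k hk => Finset.mem_range.1 (Finset.mem_powerset.1 hA hk)
  refine ⟨H A, hnn A, ?_, ?_⟩
  · -- the part of `|x k|` above the maximum over the other members of `A`
    set P : ℕ → κ → ℝ := fun k i => max (|x k i| - H (A.erase k) i) 0 with hP
    have hPε : ∀ k ∈ A, ε ≤ ∑ i, w i * P k i := by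
      intro k hk
      have h1 := hmax (A.erase k)
        (Finset.mem_powerset.2 ((Finset.erase_subset _ _).trans (Finset.mem_powerset.1 hA)))
      have h2 : ∑ i, w i * H A i = ∑ i, w i * H (A.erase k) i + ∑ i, w i * P k i := by
        rw [← Finset.sum_add_distrib]
        refine Finset.sum_congr rfl fun i _ => ?_
        have : H A i = max |x k i| (H (A.erase k) i) := by
          rw [← hins, Finset.insert_erase hk]
        rw [this, ← mul_add, hP]
        congr 1
        simp only
        rcases le_total |x k i| (H (A.erase k) i) with h | h
        · rw [max_eq_right h, max_eq_right (by linarith)]; ring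
        · rw [max_eq_left h, max_eq_left (by linarith)]; ring
      have h3 : ((A.erase k).card : ℝ) + 1 = A.card := by
        exact_mod_cast Finset.card_erase_add_one hk
      have h4 : ε * (A.card : ℝ) = ε * (A.erase k).card + ε := by rw [← h3]; ring
      linarith
    have hPpos : ∀ k ∈ A, ∀ i, 0 < P k i → ∀ l ∈ A, l ≠ k → P k i ≤ |x k i| - |x l i| ∧
        |x l i| < |x k i| := by
      intro k hk i hi l hl hlk
      have h1 := hle (A.erase k) i l (Finset.mem_erase.2 ⟨hlk, hl⟩)
      have h2 : 0 < |x k i| - H (A.erase k) i := by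
        by_contra hcon
        simp only [hP] at hi
        rw [max_eq_right (not_lt.1 hcon)] at hi
        exact lt_irrefl _ hi
      have h3 : P k i = |x k i| - H (A.erase k) i := max_eq_left h2.le
      constructor <;> linarith
    set q := A.card / 2 with hq
    have hqA : 2 * q ≤ A.card := by omega
    have hqle : (q : ℝ) ≤ (D / ε) ^ 2 := by
      rcases Nat.eq_zero_or_pos q with h0 | h0
      · rw [h0]; simp only [Nat.cast_zero]; positivity
      set ν : ℕ → ℕ := fun k => if hk : k < A.card then A.orderEmbOfFin rfl ⟨k, hk⟩ else 0 with hν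
      have hνA : ∀ k < 2 * q, ν k ∈ A := by
        intro k hk
        have : k < A.card := by omega
        simp only [hν, this, dif_pos]
        exact Finset.orderEmbOfFin_mem _ _ _
      have hνm : ∀ k l, k < l → l < 2 * q → ν k < ν l := by
        intro k l hkl hl
        have h1 : l < A.card := by omega
        have h2 : k < A.card := by omega
        simp only [hν, h1, h2, dif_pos]
        exact (A.orderEmbOfFin rfl).strictMono hkl
      set σ : κ → ℕ := fun i => if h : ∃ l < q, 0 < P (ν (2 * l)) i then h.choose else 0 with hσ
      have hσq : ∀ i, σ i < q := by
        intro i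
        simp only [hσ]
        split_ifs with h
        · exact h.choose_spec.1
        · exact h0
      have hsum : ∀ i, ∑ l ∈ Finset.range q, P (ν (2 * l)) i ≤
          |x (ν (2 * σ i + 1)) i - x (ν (2 * σ i)) i| := by
        intro i
        by_cases h : ∃ l < q, 0 < P (ν (2 * l)) i
        · have hσi : 0 < P (ν (2 * σ i)) i := by
            simp only [hσ, h, dif_pos]
            exact h.choose_spec.2
          have hlt := hσq i
          rw [Finset.sum_eq_single (σ i)]
          · have := (hPpos _ (hνA (2 * σ i) (by omega)) i hσi _ (hνA (2 * σ i + 1) (by omega))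
              (hνm (2 * σ i) (2 * σ i + 1) (by omega) (by omega)).ne').1
            refine this.trans ?_
            rw [abs_sub_comm]
            exact abs_sub_abs_le_abs_sub _ _
          · intro l hl hne
            have hl' := Finset.mem_range.1 hl
            by_contra hcon
            have hpos : 0 < P (ν (2 * l)) i := lt_of_le_of_ne (le_max_right _ _) (Ne.symm hcon)
            have hne' : ν (2 * l) ≠ ν (2 * σ i) := by
              rcases lt_or_gt_of_ne hne with h | h
              · exact (hνm (2 * l) (2 * σ i) (by omega) (by omega)).ne
              · exact (hνm (2 * σ i) (2 * l) (by omega) (by omega)).ne'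
            have e1 := (hPpos _ (hνA (2 * l) (by omega)) i hpos _
              (hνA (2 * σ i) (by omega)) hne'.symm).2
            have e2 := (hPpos _ (hνA (2 * σ i) (by omega)) i hσi _
              (hνA (2 * l) (by omega)) hne').2
            linarith
          · intro hn; exact absurd (Finset.mem_range.2 hlt) hn
        · push Not at h
          exact (Finset.sum_nonpos fun l hl => h l (Finset.mem_range.1 hl)).trans (abs_nonneg _)
      have h1 : q * ε ≤ D * √q := by
        calc (q : ℝ) * ε = ∑ l ∈ Finset.range q, ε := by simp
          _ ≤ ∑ l ∈ Finset.range q, ∑ i, w i * P (ν (2 * l)) i :=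
              Finset.sum_le_sum fun l hl => hPε _ (hνA _ (by
                have := Finset.mem_range.1 hl; omega))
          _ = ∑ i, w i * ∑ l ∈ Finset.range q, P (ν (2 * l)) i := by
              rw [Finset.sum_comm]
              exact Finset.sum_congr rfl fun i _ => by rw [Finset.mul_sum]
          _ ≤ ∑ i, w i * |x (ν (2 * σ i + 1)) i - x (ν (2 * σ i)) i| :=
              Finset.sum_le_sum fun i _ => mul_le_mul_of_nonneg_left (hsum i) (hw i)
          _ ≤ D * √q := hM q ν (fun k hk => hAN _ (hνA k hk)) hνm σ hσq
      have hsq : √(q : ℝ) ^ 2 = q := Real.sq_sqrt (Nat.cast_nonneg q)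
      have hspos : 0 < √(q : ℝ) := Real.sqrt_pos.2 (by exact_mod_cast h0)
      have h2 : √(q : ℝ) ≤ D / ε := by
        rw [le_div_iff₀ hε]
        nlinarith
      calc (q : ℝ) = √(q : ℝ) ^ 2 := hsq.symm
        _ ≤ (D / ε) ^ 2 := by gcongr
    have hcard : (A.card : ℝ) ≤ 2 * q + 1 := by
      have : A.card ≤ 2 * q + 1 := by omega
      exact_mod_cast this
    have hHsum : ∀ i, H A i ≤ ∑ k ∈ A, |x k i| := by
      intro i
      have : (A.sup fun k => ‖x k i‖₊) ≤ ∑ k ∈ A, ‖x k i‖₊ :=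
        Finset.sup_le fun k hk => Finset.single_le_sum (f := fun k => ‖x k i‖₊)
          (fun _ _ => zero_le) hk
      have := NNReal.coe_le_coe.2 this
      simpa [hH, Real.norm_eq_abs] using this
    calc ∑ i, w i * H A i ≤ ∑ i, w i * ∑ k ∈ A, |x k i| :=
          Finset.sum_le_sum fun i _ => mul_le_mul_of_nonneg_left (hHsum i) (hw i)
      _ = ∑ k ∈ A, ∑ i, w i * |x k i| := by
          rw [Finset.sum_comm]
          exact Finset.sum_congr rfl fun i _ => by rw [Finset.mul_sum]
      _ ≤ ∑ k ∈ A, D := Finset.sum_le_sum fun k hk => hb k (hAN k hk)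
      _ = A.card * D := by simp
      _ ≤ (2 * (D / ε) ^ 2 + 1) * D := by gcongr; linarith
  · intro k hk
    by_cases hkA : k ∈ A
    · refine (Finset.sum_nonpos fun i _ => ?_).trans hε.le
      rw [max_eq_right (by linarith [hle A i k hkA]), mul_zero]
    · have h1 := hmax (insert k A) (Finset.mem_powerset.2
        (Finset.insert_subset (Finset.mem_range.2 hk) (Finset.mem_powerset.1 hA)))
      have h2 : ∑ i, w i * H (insert k A) i =
          ∑ i, w i * H A i + ∑ i, w i * max (|x k i| - H A i) 0 := by
        rw [← Finset.sum_add_distrib]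
        refine Finset.sum_congr rfl fun i _ => ?_
        rw [hins, ← mul_add]
        congr 1
        rcases le_total |x k i| (H A i) with h | h
        · rw [max_eq_right h, max_eq_right (by linarith)]; ring
        · rw [max_eq_left h, max_eq_left (by linarith)]; ring
      rw [Finset.card_insert_of_notMem hkA] at h1
      push_cast at h1
      linarith

/-! ### Stabilization by convex combinations -/

/-- Among `p ^ R` vectors with a bounded quadratic energy there are `p` consecutive blocks with
convex combinations that are close to each other: if `p` equal blocks all contain convex
combinations whose energy nearly attains the infimum `δ` over their union, the parallelogram law
applies; otherwise the infimum increases by `η` in one of these blocks. -/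
theorem exists_blocks_energy_le {E κ : Type*} [AddCommGroup E] [Module ℝ E] [Fintype κ]
    (c : κ → ℝ) (φ : E →ₗ[ℝ] κ → ℝ) (u : ℕ → E) {p : ℕ} {η : ℝ} (R : ℕ) :
    ∀ (a : ℕ) (δ : ℝ),
      (∀ v ∈ convexHull ℝ (u '' Set.Ico a (a + p ^ R)), δ ≤ ∑ i, c i * φ v i ^ 2) →
      (∀ k, a ≤ k → k < a + p ^ R → ∑ i, c i * φ (u k) i ^ 2 < δ + R * η) →
      0 < p →
      ∃ (J : ℕ → Set ℕ) (v : ℕ → E),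
        (∀ l < p, J l ⊆ Set.Ico a (a + p ^ R)) ∧
        (∀ k l, k < l → l < p → ∀ a ∈ J k, ∀ b ∈ J l, a < b) ∧
        (∀ l < p, v l ∈ convexHull ℝ (u '' J l)) ∧
        ∀ k < p, ∀ l < p, ∑ i, c i * (φ (v k) i - φ (v l) i) ^ 2 ≤ 4 * η := by
  induction R with
  | zero =>
    intro a δ h1 h2 _
    have h3 := h1 (u a) (subset_convexHull _ _ ⟨a, by simp, rfl⟩)
    have h4 := h2 a le_rfl (by simp)
    simp only [Nat.cast_zero, zero_mul, add_zero] at h4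
    exact absurd h3 (not_le.2 h4)
  | succ R ih =>
    intro a δ h1 h2 hp
    set J : ℕ → Set ℕ := fun l => Set.Ico (a + l * p ^ R) (a + l * p ^ R + p ^ R) with hJ
    have hJs : ∀ l < p, J l ⊆ Set.Ico a (a + p ^ (R + 1)) := by
      intro l hl k hk
      simp only [hJ, Set.mem_Ico] at hk ⊢
      have : (l + 1) * p ^ R ≤ p * p ^ R := Nat.mul_le_mul_right _ hl
      rw [pow_succ']
      constructor
      · omega
      · nlinarith
    by_cases hgood : ∀ l < p, ∃ v ∈ convexHull ℝ (u '' J l), ∑ i, c i * φ v i ^ 2 ≤ δ + η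
    · choose! v hv hvη using hgood
      refine ⟨J, v, hJs, ?_, hv, ?_⟩
      · intro k l hkl hl b hb d hd
        simp only [hJ, Set.mem_Ico] at hb hd
        have : (k + 1) * p ^ R ≤ l * p ^ R := Nat.mul_le_mul_right _ hkl
        nlinarith
      · intro k hk l hl
        have hmem : ∀ l < p, v l ∈ convexHull ℝ (u '' Set.Ico a (a + p ^ (R + 1))) := fun l hl =>
          convexHull_mono (Set.image_mono (hJs l hl)) (hv l hl)
        have hmid := h1 _ ((convex_convexHull ℝ _) (hmem k hk) (hmem l hl)
          (show (0 : ℝ) ≤ 1 / 2 by norm_num) (show (0 : ℝ) ≤ 1 / 2 by norm_num) (by norm_num))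
        have hpar : ∑ i, c i * (φ (v k) i - φ (v l) i) ^ 2 =
            2 * ∑ i, c i * φ (v k) i ^ 2 + 2 * ∑ i, c i * φ (v l) i ^ 2 -
              4 * ∑ i, c i * φ ((1 / 2 : ℝ) • v k + (1 / 2 : ℝ) • v l) i ^ 2 := by
          simp only [Finset.mul_sum, ← Finset.sum_add_distrib, ← Finset.sum_sub_distrib]
          refine Finset.sum_congr rfl fun i _ => ?_
          simp only [map_add, map_smul, Pi.add_apply, Pi.smul_apply, smul_eq_mul]
          ring
        have e1 := hvη k hk
        have e2 := hvη l hl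
        linarith
    · push Not at hgood
      obtain ⟨l, hl, hbad⟩ := hgood
      obtain ⟨J', v, hJ', hJm, hv, hclose⟩ := ih (a + l * p ^ R) (δ + η)
        (fun v hv => (hbad v hv).le)
        (fun k hk1 hk2 => by
          have hk := hJs l hl (show k ∈ J l from ⟨hk1, hk2⟩)
          have := h2 k hk.1 hk.2
          push_cast at this
          linarith) hp
      exact ⟨J', v, fun l' hl' => (hJ' l' hl').trans (hJs l hl), hJm, hv, hclose⟩

theorem sum_mul_abs_sq_le {κ : Type*} [Fintype κ] {w h z : κ → ℝ} (hw : ∀ i, 0 ≤ w i)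
    (hh : ∀ i, 0 ≤ h i) (hz : ∀ i, h i = 0 → z i = 0) :
    (∑ i, w i * |z i|) ^ 2 ≤ (∑ i, w i / h i * z i ^ 2) * ∑ i, w i * h i := by
  refine Finset.sum_sq_le_sum_mul_sum_of_sq_le_mul _ (fun i _ => ?_) (fun i _ => ?_) (fun i _ => ?_)
  · exact mul_nonneg (div_nonneg (hw i) (hh i)) (sq_nonneg _)
  · exact mul_nonneg (hw i) (hh i)
  · refine le_of_eq ?_
    rw [mul_pow, sq_abs]
    rcases eq_or_ne (h i) 0 with h0 | h0
    · simp [h0, hz i h0]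
    · field_simp

/-- A sequence of length `p ^ R` whose terms and maxima of differences satisfy the estimates of a
tame sequence for one weight has `p` convex combinations over consecutive blocks that are
`ε`-close to each other in the weighted `ℓ¹`-norm. After truncation at `h`, the terms are bounded in the Hilbert space `ℓ²(w / h)`, in which the norm controls that of `ℓ¹(w)`. -/
theorem exists_blocks_close {κ : Type*} [Fintype κ] {w : κ → ℝ} (hw : ∀ i, 0 ≤ w i)
    {x : ℕ → κ → ℝ} {p R : ℕ} {D : ℝ} (hD : 0 ≤ D)
    (hb : ∀ k < p ^ R, ∑ i, w i * |x k i| ≤ D)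
    (hM : ∀ (q : ℕ) (ν : ℕ → ℕ), (∀ k < 2 * q, ν k < p ^ R) →
      (∀ k l, k < l → l < 2 * q → ν k < ν l) → ∀ σ : κ → ℕ, (∀ i, σ i < q) →
        ∑ i, w i * |x (ν (2 * σ i + 1)) i - x (ν (2 * σ i)) i| ≤ D * √q)
    {ε Λ η : ℝ} (hε : 0 < ε) (hΛ : (2 * (D / (ε / 4)) ^ 2 + 1) * D ≤ Λ)
    (hη : 4 * η * Λ ≤ (ε / 2) ^ 2) (hR : Λ < R * η) (hη0 : 0 ≤ η) (hp : 0 < p) :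
    ∃ (J : ℕ → Set ℕ) (v : ℕ → κ → ℝ),
        (∀ l < p, ∀ a ∈ J l, a < p ^ R) ∧
        (∀ k l, k < l → l < p → ∀ a ∈ J k, ∀ b ∈ J l, a < b) ∧
        (∀ l < p, v l ∈ convexHull ℝ (x '' J l)) ∧
        ∀ k < p, ∀ l < p, ∑ i, w i * |v k i - v l i| ≤ ε := by
  obtain ⟨h, hh, hsum, hexc⟩ := exists_truncation hw hD hb hM (show 0 < ε / 4 by linarith)
  -- the truncation of `x k` to the interval `[-h, h]`
  set t : ℕ → κ → ℝ := fun k i => max (-h i) (min (x k i) (h i)) with ht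
  have htabs : ∀ k i, |t k i| ≤ h i := by
    intro k i
    rw [abs_le]
    exact ⟨le_max_left _ _, max_le (by linarith [hh i]) (min_le_right _ _)⟩
  have htsub : ∀ k i, |x k i - t k i| ≤ max (|x k i| - h i) 0 := by
    intro k i
    have h0 := hh i
    simp only [ht]
    rcases le_total (x k i) (h i) with h1 | h1
    · rw [min_eq_left h1]
      rcases le_total (-h i) (x k i) with h2 | h2
      · rw [max_eq_right h2, sub_self, abs_zero]; exact le_max_right _ _
      · rw [max_eq_left h2]
        refine le_max_of_le_left ?_
        rw [abs_of_nonpos (by linarith), abs_of_nonpos (by linarith)]; linarith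
    · rw [min_eq_right h1, max_eq_right (by linarith)]
      refine le_max_of_le_left ?_
      rw [abs_of_nonneg (by linarith), abs_of_nonneg (by linarith)]
  have hQ : ∀ k, ∑ i, w i / h i * t k i ^ 2 ≤ ∑ i, w i * h i := by
    intro k
    refine Finset.sum_le_sum fun i _ => ?_
    rcases eq_or_ne (h i) 0 with h0 | h0
    · simp [h0]
    · have hpos : 0 < h i := lt_of_le_of_ne (hh i) (Ne.symm h0)
      have h1 : t k i ^ 2 ≤ h i ^ 2 := sq_le_sq' (abs_le.1 (htabs k i)).1 (abs_le.1 (htabs k i)).2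
      calc w i / h i * t k i ^ 2 ≤ w i / h i * h i ^ 2 :=
            mul_le_mul_of_nonneg_left h1 (div_nonneg (hw i) (hh i))
        _ = w i * h i := by field_simp
  obtain ⟨J, v, hJ, hJm, hv, hclose⟩ := exists_blocks_energy_le (fun i => w i / h i)
    (LinearMap.snd ℝ (κ → ℝ) (κ → ℝ)) (fun k => (x k, t k)) (p := p) (η := η) R 0 0
    (fun v _ => Finset.sum_nonneg fun i _ => mul_nonneg (div_nonneg (hw i) (hh i)) (sq_nonneg _))
    (fun k _ _ => by
      have := hQ k
      simp only [LinearMap.snd_apply]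
      linarith) hp
  simp only [zero_add] at hJ
  refine ⟨J, fun l => (v l).1, fun l hl a ha => (hJ l hl ha).2, hJm, fun l hl => ?_,
    fun k hk l hl => ?_⟩
  · have h1 := Set.mem_image_of_mem (LinearMap.fst ℝ (κ → ℝ) (κ → ℝ)) (hv l hl)
    rw [LinearMap.image_convexHull, Set.image_image] at h1
    exact h1
  · have herr : ∀ l < p, ∑ i, w i * |(v l).1 i - (v l).2 i| ≤ ε / 4 := by
      intro l hl
      have := sum_mul_abs_sub_le_of_mem_convexHull hw
        (LinearMap.fst ℝ (κ → ℝ) (κ → ℝ) - LinearMap.snd ℝ (κ → ℝ) (κ → ℝ)) 0 (C := ε / 4)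
        (S := (fun k => (x k, t k)) '' J l) ?_ (hv l hl)
      · simpa using this
      · rintro _ ⟨a, ha, rfl⟩
        refine le_trans (Finset.sum_le_sum fun i _ => ?_) (hexc a (hJ l hl ha).2)
        refine mul_le_mul_of_nonneg_left ?_ (hw i)
        simpa using htsub a i
    -- where `h` vanishes, so do all truncations and their convex combinations
    have hzero : ∀ l < p, ∀ i, h i = 0 → (v l).2 i = 0 := by
      intro l hl i hi
      have hc : Convex ℝ {z : (κ → ℝ) × (κ → ℝ) | z.2 i = 0} := by
        intro a ha b hb s r _ _ _
        simp only [Set.mem_ofPred_eq] at ha hb ⊢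
        simp [ha, hb]
      refine convexHull_min ?_ hc (hv l hl)
      rintro _ ⟨a, _, rfl⟩
      have := htabs a i
      rw [hi] at this
      exact abs_nonpos_iff.1 this
    have hmain : ∑ i, w i * |(v k).2 i - (v l).2 i| ≤ ε / 2 := by
      have h1 := sum_mul_abs_sq_le (z := fun i => (v k).2 i - (v l).2 i) hw hh
        (fun i hi => by simp [hzero k hk i hi, hzero l hl i hi])
      have h2 := hclose k hk l hl
      simp only [LinearMap.snd_apply] at h2
      have h3 : 0 ≤ ∑ i, w i * h i := Finset.sum_nonneg fun i _ => mul_nonneg (hw i) (hh i)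
      refine abs_le_of_sq_le_sq' (h1.trans ?_) (by linarith) |>.2
      calc _ ≤ 4 * η * ∑ i, w i * h i := mul_le_mul_of_nonneg_right h2 h3
        _ ≤ 4 * η * Λ := by
            refine mul_le_mul_of_nonneg_left (hsum.trans hΛ) (by linarith)
        _ ≤ _ := hη
    calc ∑ i, w i * |(v k).1 i - (v l).1 i|
        ≤ ∑ i, (w i * |(v k).1 i - (v k).2 i| + w i * |(v k).2 i - (v l).2 i| +
            w i * |(v l).1 i - (v l).2 i|) := by
          refine Finset.sum_le_sum fun i _ => ?_
          rw [← mul_add, ← mul_add]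
          refine mul_le_mul_of_nonneg_left ?_ (hw i)
          have e1 := abs_sub_le ((v k).1 i) ((v k).2 i) ((v l).1 i)
          have e2 := abs_sub_le ((v k).2 i) ((v l).2 i) ((v l).1 i)
          rw [abs_sub_comm ((v l).2 i) ((v l).1 i)] at e2
          linarith
      _ ≤ ε := by
          rw [Finset.sum_add_distrib, Finset.sum_add_distrib]
          linarith [herr k hk, herr l hl]

/-! ### Iterating the stabilization -/

/-- The number of terms that suffices for `m` successive stabilizations, each of which turns
`p ^ R` terms into `p`. -/
def stageLength (R : ℕ) : ℕ → ℕ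
  | 0 => 1
  | m + 1 => stageLength R m ^ R + 1

theorem stageLength_pos (R m : ℕ) : 0 < stageLength R m := by
  cases m <;> simp [stageLength]

/-- A long tame sequence has block convex combinations `y 0, …, y m` such that, in the
`ℓ¹`-norm weighted by any of them, all later ones nearly coincide. -/
theorem IsTame.exists_stable {ι : Type*} [Fintype ι] {D ε Λ η : ℝ} {R : ℕ} (hD : 0 ≤ D)
    (hε : 0 < ε) (hΛ : (2 * (D / (ε / 4)) ^ 2 + 1) * D ≤ Λ) (hη : 4 * η * Λ ≤ (ε / 2) ^ 2)
    (hR : Λ < R * η) (hη0 : 0 ≤ η) (m : ℕ) :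
    ∀ (N : ℕ) (x : ℕ → ι ⊕ ι → ℝ), IsTame D N x → stageLength R m ≤ N →
      ∃ (J : ℕ → Set ℕ) (y : ℕ → ι ⊕ ι → ℝ),
        (∀ r < m + 1, ∀ a ∈ J r, a < N) ∧
        (∀ r s, r < s → s < m + 1 → ∀ a ∈ J r, ∀ b ∈ J s, a < b) ∧
        (∀ r < m + 1, y r ∈ convexHull ℝ (x '' J r)) ∧
        ∀ r s t, r < s → s < m + 1 → r < t → t < m + 1 →
          ∑ i, |y r i.swap| * |y s i - y t i| ≤ ε := by
  induction m with
  | zero =>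
    intro N x _ hN
    refine ⟨fun _ => {0}, fun _ => x 0, ?_, ?_, ?_, ?_⟩
    · intro r _ a ha
      rw [Set.mem_singleton_iff.1 ha]
      exact hN
    · intro r s hrs hs; omega
    · intro r _
      exact subset_convexHull _ _ ⟨0, rfl, rfl⟩
    · intro r s t hrs hs; omega
  | succ m ih =>
    intro N x hx hN
    have hN' : stageLength R m ^ R + 1 ≤ N := hN
    obtain ⟨J₁, v, hJ₁, hJ₁m, hv, hclose⟩ := exists_blocks_close
      (w := fun i => |x 0 i.swap|) (fun i => abs_nonneg _) (x := fun k => x (k + 1))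
      (p := stageLength R m) (R := R) hD
      (fun k hk => hx.sum_le 0 (by omega) (k + 1) (by omega))
      (fun q ν hν hνm σ hσ => hx.sum_diff_le 0 (by omega) q (fun k => ν k + 1)
        (fun k hk => by have := hν k hk; omega)
        (fun k l hkl hl => by have := hνm k l hkl hl; omega) σ hσ)
      hε hΛ hη hR hη0 (stageLength_pos R m)
    set J₂ : ℕ → Set ℕ := fun l => (· + 1) '' J₁ l with hJ₂
    have hJ₂N : ∀ l < stageLength R m, ∀ a ∈ J₂ l, a < N := by
      rintro l hl _ ⟨a, ha, rfl⟩
      have := hJ₁ l hl a ha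
      simp only
      omega
    have hJ₂m : ∀ k l, k < l → l < stageLength R m → ∀ a ∈ J₂ k, ∀ b ∈ J₂ l, a < b := by
      rintro k l hkl hl _ ⟨a, ha, rfl⟩ _ ⟨b, hb, rfl⟩
      have := hJ₁m k l hkl hl a ha b hb
      simp only
      omega
    have hv₂ : ∀ l < stageLength R m, v l ∈ convexHull ℝ (x '' J₂ l) := by
      intro l hl
      rw [hJ₂, Set.image_image]
      exact hv l hl
    obtain ⟨J₃, y, hJ₃, hJ₃m, hy, hstab⟩ :=
      ih (stageLength R m) v (hx.of_convexHull hJ₂N hJ₂m hv₂) le_rfl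
    refine ⟨fun r => Nat.casesOn r {0} fun r => ⋃ l ∈ J₃ r, J₂ l,
      fun r => Nat.casesOn r (x 0) y, ?_, ?_, ?_, ?_⟩
    · rintro (_ | r) hr a ha
      · rw [Set.mem_singleton_iff.1 ha]; omega
      · simp only [Set.mem_iUnion] at ha
        obtain ⟨l, hl, ha⟩ := ha
        exact hJ₂N l (hJ₃ r (by omega) l hl) a ha
    · rintro (_ | r) (_ | s) hrs hs a ha b hb
      · omega
      · simp only [Set.mem_iUnion] at hb
        obtain ⟨l, hl, c, hc, rfl⟩ := hb
        rw [Set.mem_singleton_iff.1 ha]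
        exact Nat.succ_pos c
      · omega
      · simp only [Set.mem_iUnion] at ha hb
        obtain ⟨k, hk, ha⟩ := ha
        obtain ⟨l, hl, hb⟩ := hb
        exact hJ₂m k l (hJ₃m r s (by omega) (by omega) k hk l hl) (hJ₃ s (by omega) l hl) a ha b hb
    · rintro (_ | r) hr
      · exact subset_convexHull _ _ ⟨0, rfl, rfl⟩
      · refine convexHull_min ?_ (convex_convexHull ℝ _) (hy r (by omega))
        rintro _ ⟨l, hl, rfl⟩
        refine convexHull_mono (Set.image_mono ?_) (hv₂ l (hJ₃ r (by omega) l hl))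
        exact Set.subset_biUnion_of_mem (u := fun l => J₂ l) hl
    · rintro (_ | r) (_ | s) (_ | t) hrs hs hrt ht
      all_goals first | omega | skip
      · refine sum_mul_abs_sub_le_of_mem_convexHull₂ (fun i => abs_nonneg _) ?_
          (hy s (by omega)) (hy t (by omega))
        rintro _ ⟨k, hk, rfl⟩ _ ⟨l, hl, rfl⟩
        exact hclose k (hJ₃ s (by omega) k hk) l (hJ₃ t (by omega) l hl)
      · exact hstab r s t (by omega) (by omega) (by omega) (by omega)

/-! ### The contradiction from a stable sequence -/

/-- A tame sequence of pairs cannot both be stable and satisfy the biorthogonality relations of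
the James space. Let `Z` be the last term and let `A r` be the decreasing sets where the weight
`|Z i.swap|` is more than twice that of each of `y 0, …, y r`. With respect to this weight,
stability makes `y s` close to `Z` off `A (s - 1)` and close to `0` on `A (s + 1)`, and the
estimate for maxima of differences makes the remaining part negligible for a suitable `s`, for
which the complement of `A (s - 1)` is moreover nearly invariant under the swap. So the
products of `y s` and `Z` in the two orders sum to nearly the same value, namely the sum
of the products of the coordinates of `Z` over the complement of `A (s - 1)`; but one of these
sums is `0` and the other is `1`. -/
theorem IsTame.false_of_stable {ι : Type*} [Fintype ι] {D ε : ℝ} {q : ℕ} {y : ℕ → ι ⊕ ι → ℝ}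
    (hy : IsTame D (4 * q + 1) y)
    (hstab : ∀ r s t, r < s → s < 4 * q + 1 → r < t → t < 4 * q + 1 →
      ∑ i, |y r i.swap| * |y s i - y t i| ≤ ε)
    (h0 : ∀ r s, r < s → s < 4 * q + 1 → ∑ i, y r (Sum.inl i) * y s (Sum.inr i) = 0)
    (h1 : ∀ r s, r < s → s < 4 * q + 1 → ∑ i, y s (Sum.inl i) * y r (Sum.inr i) = 1)
    (hq : 0 < q) (hD : 24 * D ≤ √q) (hε : (32 * q + 2) * ε ≤ 1 / 2) : False := by
  classical
  set Z := y (4 * q) with hZ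
  set A : ℕ → ι ⊕ ι → Prop := fun r i => ∀ r' ≤ r, 2 * |y r' i.swap| < |Z i.swap| with hA
  have hε0 : 0 ≤ ε := by
    refine le_trans ?_ (hstab 0 1 1 one_pos (by omega) one_pos (by omega))
    exact Finset.sum_nonneg fun i _ => mul_nonneg (abs_nonneg _) (abs_nonneg _)
  have hAanti : ∀ r s i, r ≤ s → A s i → A r i := fun r s i hrs h r' hr' => h r' (hr'.trans hrs)
  -- off `A r`, the weight from `Z` is dominated by weights for which `y s` is close to `Z`
  have hoff : ∀ r s, r < s → s < 4 * q + 1 →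
      ∑ i, (if A r i then 0 else |Z i.swap| * |y s i - Z i|) ≤ 2 * (r + 1) * ε := by
    intro r s hrs hs
    calc ∑ i, (if A r i then 0 else |Z i.swap| * |y s i - Z i|)
        ≤ ∑ i, ∑ r' ∈ Finset.range (r + 1), 2 * (|y r' i.swap| * |y s i - Z i|) := by
          refine Finset.sum_le_sum fun i _ => ?_
          have hnn : ∀ r' ∈ Finset.range (r + 1), 0 ≤ 2 * (|y r' i.swap| * |y s i - Z i|) :=
            fun r' _ => by positivity
          split_ifs with h
          · exact Finset.sum_nonneg hnn
          · simp only [hA] at h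
            push Not at h
            obtain ⟨r', hr', hle⟩ := h
            refine le_trans ?_ (Finset.single_le_sum hnn
              (Finset.mem_range.2 (Nat.lt_succ_of_le hr')))
            rw [← mul_assoc]
            exact mul_le_mul_of_nonneg_right hle (abs_nonneg _)
      _ = ∑ r' ∈ Finset.range (r + 1), 2 * ∑ i, |y r' i.swap| * |y s i - Z i| := by
          rw [Finset.sum_comm]
          exact Finset.sum_congr rfl fun i _ => by rw [Finset.mul_sum]
      _ ≤ ∑ r' ∈ Finset.range (r + 1), 2 * ε := by
          refine Finset.sum_le_sum fun r' hr' => ?_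
          have := Finset.mem_range.1 hr'
          have := hstab r' s (4 * q) (by omega) hs (by omega) (by omega)
          linarith
      _ = 2 * (r + 1) * ε := by
          rw [Finset.sum_const, Finset.card_range, nsmul_eq_mul]; push_cast; ring
  -- on `A (s + 1)`, the weight from `Z` is dominated by that from `Z - y (s + 1)`
  have hon : ∀ s, s + 1 < 4 * q + 1 →
      ∑ i, (if A (s + 1) i then |Z i.swap| * |y s i| else 0) ≤ 2 * ε := by
    intro s hs
    calc ∑ i, (if A (s + 1) i then |Z i.swap| * |y s i| else 0)
        ≤ ∑ i, 2 * (|Z i.swap - y (s + 1) i.swap| * |y s i|) := by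
          refine Finset.sum_le_sum fun i _ => ?_
          split_ifs with h
          · have e1 := h (s + 1) le_rfl
            have e2 := abs_sub_abs_le_abs_sub (Z i.swap) (y (s + 1) i.swap)
            have e3 : |Z i.swap| ≤ 2 * |Z i.swap - y (s + 1) i.swap| := by linarith
            rw [← mul_assoc]
            exact mul_le_mul_of_nonneg_right e3 (abs_nonneg _)
          · positivity
      _ = 2 * ∑ i, |y s i.swap| * |Z i - y (s + 1) i| := by
          rw [← Finset.mul_sum, sum_swap_mul (fun i => Z i - y (s + 1) i)]
      _ ≤ 2 * ε := by
          have := hstab s (4 * q) (s + 1) (by omega) (by omega) (by omega) hs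
          linarith
  -- the parts of the index set that are lost between `A (4 * u)` and `A (4 * u + 2)`
  set G : ℕ → ι ⊕ ι → Prop := fun u i => A (4 * u) i ∧ ¬ A (4 * u + 2) i with hG
  set g : ℕ → ι ⊕ ι → ℝ := fun u i =>
    |Z i.swap| * |y (4 * u + 3) i - y (4 * u + 1) i| + |Z i.swap| * |Z i| with hg
  have hgnn : ∀ u i, 0 ≤ g u i := fun u i => by positivity
  have hsqrt : 1 ≤ √(q : ℝ) := Real.one_le_sqrt.2 (by exact_mod_cast hq)
  obtain ⟨u, hu, hgap⟩ : ∃ u < q, ∑ i, (if G u i then g u i else 0) ≤ 1 / 12 := by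
    -- the sets `G u` are disjoint, so the sum over `u` is bounded by one maximum of differences
    by_contra hcon
    push Not at hcon
    set σ : ι ⊕ ι → ℕ := fun i => if h : ∃ u < q, G u i then h.choose else 0 with hσ
    have hσq : ∀ i, σ i < q := by
      intro i
      simp only [hσ]
      split_ifs with h
      · exact h.choose_spec.1
      · exact hq
    have hpt : ∀ i, ∑ u ∈ Finset.range q, (if G u i then g u i else 0) ≤ g (σ i) i := by
      intro i
      by_cases h : ∃ u < q, G u i
      · have hσi : G (σ i) i := by
          simp only [hσ, h, dif_pos]
          exact h.choose_spec.2
        rw [Finset.sum_eq_single (σ i)]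
        · rw [if_pos hσi]
        · intro u _ hne
          refine if_neg fun hu => ?_
          rcases lt_or_gt_of_ne hne with hlt | hlt
          · exact hu.2 (hAanti _ _ i (by omega) hσi.1)
          · exact hσi.2 (hAanti _ _ i (by omega) hu.1)
        · intro hn; exact absurd (Finset.mem_range.2 (hσq i)) hn
      · push Not at h
        rw [Finset.sum_eq_zero fun u hu => if_neg (h u (Finset.mem_range.1 hu))]
        exact hgnn _ _
    have hdiff := hy.sum_diff_le (4 * q) (by omega) q (fun k => 2 * k + 1)
      (fun k hk => by omega) (fun k l hkl _ => by omega) σ hσq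
    have hZZ := hy.sum_le (4 * q) (by omega) (4 * q) (by omega)
    have hlt : ∑ u ∈ Finset.range q, (1 / 12 : ℝ) <
        ∑ u ∈ Finset.range q, ∑ i, (if G u i then g u i else 0) :=
      Finset.sum_lt_sum_of_nonempty ⟨0, Finset.mem_range.2 hq⟩
        fun u hu => hcon u (Finset.mem_range.1 hu)
    rw [Finset.sum_comm] at hlt
    have hle : ∑ i, ∑ u ∈ Finset.range q, (if G u i then g u i else 0) ≤ D * √q + D := by
      refine (Finset.sum_le_sum fun i _ => hpt i).trans ?_
      simp only [hg, Finset.sum_add_distrib]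
      refine add_le_add (le_trans (le_of_eq (Finset.sum_congr rfl fun i _ => ?_)) hdiff) hZZ
      rw [show 2 * (2 * σ i + 1) + 1 = 4 * σ i + 3 by ring,
        show 2 * (2 * σ i) + 1 = 4 * σ i + 1 by ring]
    rw [Finset.sum_const, Finset.card_range, nsmul_eq_mul] at hlt
    have hsq : √(q : ℝ) * √q = q := Real.mul_self_sqrt (Nat.cast_nonneg q)
    have hD0 : 0 ≤ D := le_trans
      (Finset.sum_nonneg fun i _ => mul_nonneg (abs_nonneg _) (abs_nonneg _)) hZZ
    nlinarith
  -- from here on `s = 4 * u + 1`; `F` compares `y s` with `Z` off `A (4 * u)` and with `0` on it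
  set Y := y (4 * u + 1) with hY
  set F : ι ⊕ ι → ℝ := fun i => Y i * Z i.swap - if A (4 * u) i then 0 else Z i * Z i.swap with hF
  have hu' : (u : ℝ) + 1 ≤ q := by exact_mod_cast hu
  have hFsum : ∑ i, |F i| ≤ 1 / 12 + (16 * q + 2) * ε := by
    have e1 := hoff (4 * u) (4 * u + 1) (by omega) (by omega)
    have e2 := hoff (4 * u + 2) (4 * u + 3) (by omega) (by omega)
    have e3 := hon (4 * u + 1) (by omega)
    calc ∑ i, |F i| ≤ ∑ i, ((if A (4 * u) i then 0 else |Z i.swap| * |Y i - Z i|) +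
          (if A (4 * u + 2) i then 0 else |Z i.swap| * |y (4 * u + 3) i - Z i|) +
          (if A (4 * u + 2) i then |Z i.swap| * |Y i| else 0) +
          (if G u i then g u i else 0)) := by
          refine Finset.sum_le_sum fun i _ => ?_
          by_cases hA0 : A (4 * u) i
          · by_cases hA2 : A (4 * u + 2) i
            · have : ¬ G u i := fun h => h.2 hA2
              simp only [hF, hA0, hA2, this, if_true, if_false, sub_zero, abs_mul]
              rw [mul_comm]
              simp
            · have : G u i := ⟨hA0, hA2⟩
              simp only [hF, hA0, hA2, this, if_true, if_false, sub_zero, abs_mul, hg]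
              have t1 := abs_sub_le (Y i) (y (4 * u + 3) i) (Z i)
              have t2 := abs_sub_abs_le_abs_sub (Y i) (Z i)
              rw [abs_sub_comm (Y i) (y (4 * u + 3) i)] at t1
              have t3 : |Y i| ≤ |y (4 * u + 3) i - Z i| + |y (4 * u + 3) i - Y i| + |Z i| := by
                linarith
              have t4 := mul_le_mul_of_nonneg_left t3 (abs_nonneg (Z i.swap))
              linarith
          · have hA2 : ¬ A (4 * u + 2) i := fun h => hA0 (hAanti _ _ i (by omega) h)
            have : ¬ G u i := fun h => hA0 h.1
            simp only [hF, hA0, hA2, this, if_false, add_zero]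
            rw [← sub_mul, abs_mul, mul_comm]
            have : 0 ≤ |Z i.swap| * |y (4 * u + 3) i - Z i| := by positivity
            linarith
      _ ≤ 1 / 12 + (16 * q + 2) * ε := by
          simp only [Finset.sum_add_distrib]
          push_cast at e1 e2 e3
          nlinarith
  -- `H` measures how far the complement of `A (4 * u)` is from being invariant under the swap
  set H : ι ⊕ ι → ℝ := fun i =>
    if ¬ A (4 * u) i ∧ A (4 * u) i.swap then |Z i.swap| * |Z i| else 0 with hH
  have hHnn : ∀ i, 0 ≤ H i := fun i => by
    simp only [hH]; split_ifs <;> positivity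
  have hHsum : ∑ i, H i ≤ 1 / 12 + 16 * q * ε := by
    have e1 := hoff (4 * u) (4 * u + 1) (by omega) (by omega)
    calc ∑ i, H i ≤ ∑ i, ((if G u i.swap then g u i.swap else 0) +
          2 * (if A (4 * u) i then 0 else |Z i.swap| * |Y i - Z i|)) := by
          refine Finset.sum_le_sum fun i _ => ?_
          by_cases h : ¬ A (4 * u) i ∧ A (4 * u) i.swap
          · simp only [hH]
            rw [if_pos h, if_neg h.1]
            by_cases hA2 : A (4 * u + 2) i.swap
            · rw [if_neg fun hG => hG.2 hA2, zero_add]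
              have t1 := hA2 (4 * u + 1) (by omega)
              rw [Sum.swap_swap] at t1
              have t2 := abs_sub_abs_le_abs_sub (Z i) (Y i)
              rw [abs_sub_comm] at t2
              have t3 : |Z i| ≤ 2 * |Y i - Z i| := by linarith
              have := mul_le_mul_of_nonneg_left t3 (abs_nonneg (Z i.swap))
              linarith
            · rw [if_pos ⟨h.2, hA2⟩]
              simp only [hg, Sum.swap_swap]
              have e1 : 0 ≤ |Z i| * |y (4 * u + 3) i.swap - y (4 * u + 1) i.swap| := by positivity
              have e2 : 0 ≤ |Z i.swap| * |Y i - Z i| := by positivity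
              linarith [mul_comm |Z i| |Z i.swap|]
          · simp only [hH]
            rw [if_neg h]
            have := hgnn u i.swap
            split_ifs <;> positivity
      _ = ∑ i, (if G u i then g u i else 0) +
          2 * ∑ i, (if A (4 * u) i then 0 else |Z i.swap| * |Y i - Z i|) := by
          rw [Finset.sum_add_distrib, Finset.mul_sum]
          congr 1
          exact Equiv.sum_comp (Equiv.sumComm ι ι) fun i => if G u i then g u i else 0
      _ ≤ 1 / 12 + 16 * q * ε := by
          push_cast at e1
          nlinarith
  have hfin : ∑ i, Z (Sum.inl i) * Y (Sum.inr i) - ∑ i, Y (Sum.inl i) * Z (Sum.inr i) ≤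
      ∑ i, |F i| + ∑ i, H i := by
    rw [← Finset.sum_sub_distrib, Fintype.sum_sum_type, Fintype.sum_sum_type,
      ← Finset.sum_add_distrib, ← Finset.sum_add_distrib, ← Finset.sum_add_distrib]
    refine Finset.sum_le_sum fun i _ => ?_
    have f1 := neg_abs_le (F (Sum.inl i))
    have f2 := le_abs_self (F (Sum.inr i))
    have z1 := le_abs_self (Z (Sum.inl i) * Z (Sum.inr i))
    have z2 := neg_abs_le (Z (Sum.inl i) * Z (Sum.inr i))
    rw [abs_mul] at z1 z2
    have z3 : 0 ≤ |Z (Sum.inl i)| * |Z (Sum.inr i)| := by positivity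
    simp only [hF, hH, Sum.swap_inl, Sum.swap_inr] at f1 f2 ⊢
    by_cases a1 : A (4 * u) (Sum.inl i) <;> by_cases a2 : A (4 * u) (Sum.inr i) <;>
      simp only [a1, a2, if_true, if_false, not_true, not_false_iff, and_true, and_false]
        at f1 f2 ⊢ <;> nlinarith
  rw [h1 (4 * u + 1) (4 * q) (by omega) (by omega), h0 (4 * u + 1) (4 * q) (by omega) (by omega)]
    at hfin
  linarith

/-! ### Signs and unconditional bases -/

/-- For a suitable choice of signs, the weighted `ℓ¹`-norm of a signed sum dominates that of the
pointwise maximum of the summands. -/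
theorem exists_signs {κ : Type*} [Fintype κ] {w : κ → ℝ} (hw : ∀ i, 0 ≤ w i) (d : ℕ → κ → ℝ)
    (q : ℕ) : ∀ z M : κ → ℝ, (∀ i, M i ≤ |z i| ∨ ∃ l < q, M i ≤ |d l i|) →
      ∃ ε : ℕ → ℝ, (∀ l, ε l = 1 ∨ ε l = -1) ∧
        ∑ i, w i * M i ≤ ∑ i, w i * |z i + ∑ l ∈ Finset.range q, ε l * d l i| := by
  classical
  induction q with
  | zero =>
    intro z M h
    refine ⟨fun _ => 1, fun _ => Or.inl rfl, Finset.sum_le_sum fun i _ => ?_⟩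
    rcases h i with h | ⟨l, hl, _⟩
    · simpa using mul_le_mul_of_nonneg_left h (hw i)
    · omega
  | succ q ih =>
    intro z M h
    -- of the two bounds for `z + d q` and `z - d q`, one is at least their average
    have key : ∀ τ : ℝ, ∃ ε : ℕ → ℝ, (∀ l, ε l = 1 ∨ ε l = -1) ∧
        ∑ i, w i * (if ∃ l < q, M i ≤ |d l i| then M i else |z i + τ * d q i|) ≤
          ∑ i, w i * |z i + τ * d q i + ∑ l ∈ Finset.range q, ε l * d l i| := by
      intro τ
      refine ih (fun i => z i + τ * d q i) _ fun i => ?_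
      split_ifs with hi
      · exact Or.inr hi
      · exact Or.inl le_rfl
    have hsum : 2 * ∑ i, w i * M i ≤
        ∑ i, w i * (if ∃ l < q, M i ≤ |d l i| then M i else |z i + 1 * d q i|) +
        ∑ i, w i * (if ∃ l < q, M i ≤ |d l i| then M i else |z i + (-1) * d q i|) := by
      rw [Finset.mul_sum, ← Finset.sum_add_distrib]
      refine Finset.sum_le_sum fun i _ => ?_
      split_ifs with hi
      · linarith
      · rw [← mul_add, ← mul_assoc, mul_comm 2, mul_assoc]
        refine mul_le_mul_of_nonneg_left ?_ (hw i)
        have e1 := abs_add_le (z i + 1 * d q i) (z i + (-1) * d q i)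
        have e2 := abs_sub (z i + 1 * d q i) (z i + (-1) * d q i)
        rw [show z i + 1 * d q i + (z i + (-1) * d q i) = 2 * z i by ring, abs_mul, abs_two] at e1
        rw [show z i + 1 * d q i - (z i + (-1) * d q i) = 2 * d q i by ring, abs_mul, abs_two] at e2
        rcases h i with h | ⟨l, hl, hle⟩
        · linarith
        · rcases Nat.lt_succ_iff_lt_or_eq.1 hl with hl | rfl
          · exact absurd ⟨l, hl, hle⟩ hi
          · linarith
    have fin : ∀ τ : ℝ, (τ = 1 ∨ τ = -1) → ∑ i, w i * M i ≤
        ∑ i, w i * (if ∃ l < q, M i ≤ |d l i| then M i else |z i + τ * d q i|) →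
        ∃ ε : ℕ → ℝ, (∀ l, ε l = 1 ∨ ε l = -1) ∧
          ∑ i, w i * M i ≤ ∑ i, w i * |z i + ∑ l ∈ Finset.range (q + 1), ε l * d l i| := by
      intro τ hτ hle
      obtain ⟨ε, hε, hb⟩ := key τ
      refine ⟨Function.update ε q τ, fun l => ?_, hle.trans (hb.trans_eq ?_)⟩
      · rcases eq_or_ne l q with rfl | hl
        · simpa using hτ
        · simpa [hl] using hε l
      · refine Finset.sum_congr rfl fun i _ => ?_
        rw [Finset.sum_range_succ, Function.update_self]
        congr 2
        have : ∑ l ∈ Finset.range q, Function.update ε q τ l * d l i =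
            ∑ l ∈ Finset.range q, ε l * d l i :=
          Finset.sum_congr rfl fun l hl => by
            rw [Function.update_of_ne (Finset.mem_range.1 hl).ne]
        rw [this]
        ring
    rcases le_total (∑ i, w i * M i)
      (∑ i, w i * (if ∃ l < q, M i ≤ |d l i| then M i else |z i + 1 * d q i|)) with h1 | h1
    · exact fin 1 (Or.inl rfl) h1
    · exact fin (-1) (Or.inr rfl) (by linarith)

theorem exists_signs_selector {κ : Type*} [Fintype κ] {w : κ → ℝ} (hw : ∀ i, 0 ≤ w i)
    (d : ℕ → κ → ℝ) {q : ℕ} {σ : κ → ℕ} (hσ : ∀ i, σ i < q) :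
    ∃ ε : ℕ → ℝ, (∀ l, ε l = 1 ∨ ε l = -1) ∧
      ∑ i, w i * |d (σ i) i| ≤ ∑ i, w i * |∑ l ∈ Finset.range q, ε l * d l i| := by
  have := exists_signs hw d q 0 (fun i => |d (σ i) i|) fun i => Or.inr ⟨σ i, hσ i, le_rfl⟩
  simpa using this

section UnconditionalConstant

variable {ι X : Type*} [Fintype ι] [NormedAddCommGroup X] [NormedSpace ℝ X]

theorem norm_sum_signs_le {c : Module.Basis ι ℝ X} {B : ℝ}
    (hc : unconditionalConstant c ≤ (B : EReal)) {ε : ι → ℝ} (hε : ∀ i, ε i = 1 ∨ ε i = -1)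
    (x : X) : ‖∑ i, (ε i * c.repr x i) • c i‖ ≤ B * ‖x‖ := by
  simp only [unconditionalConstant, iSup_le_iff] at hc
  have h := EReal.coe_le_coe_iff.1 (hc ε hε fun i => c.repr x i)
  rw [c.sum_repr] at h
  rcases eq_or_ne x 0 with rfl | hx
  · simp
  · rwa [div_le_iff₀ (norm_pos_iff.2 hx)] at h

theorem one_le_unconditionalConstant [Nontrivial X] (c : Module.Basis ι ℝ X) :
    (1 : EReal) ≤ unconditionalConstant c := by
  obtain ⟨x, hx⟩ := exists_ne (0 : X)
  refine le_iSup₂_of_le (fun _ => 1) (fun _ => Or.inl rfl)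
    (le_iSup_of_le (fun i => c.repr x i) ?_)
  simp only [one_mul]
  rw [c.sum_repr, div_self (norm_ne_zero_iff.2 hx)]
  exact le_rfl

theorem sum_abs_repr_mul_le {c : Module.Basis ι ℝ X} {B : ℝ}
    (hc : unconditionalConstant c ≤ (B : EReal)) (x : X) (φ : X →ₗ[ℝ] ℝ) {C : ℝ} (hC : 0 ≤ C)
    (hφ : ∀ x, |φ x| ≤ C * ‖x‖) : ∑ i, |φ (c i)| * |c.repr x i| ≤ C * (B * ‖x‖) := by
  classical
  set ε : ι → ℝ := fun i => if 0 ≤ c.repr x i * φ (c i) then 1 else -1 with hε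
  have h1 : ∀ i, |φ (c i)| * |c.repr x i| = ε i * c.repr x i * φ (c i) := by
    intro i
    rw [← abs_mul, mul_comm (φ (c i))]
    simp only [hε]
    split_ifs with h
    · rw [abs_of_nonneg h]; ring
    · rw [abs_of_neg (not_le.1 h)]; ring
  calc ∑ i, |φ (c i)| * |c.repr x i| = φ (∑ i, (ε i * c.repr x i) • c i) := by
        rw [map_sum]
        exact Finset.sum_congr rfl fun i _ => by rw [h1, map_smul, smul_eq_mul]
    _ ≤ |φ (∑ i, (ε i * c.repr x i) • c i)| := le_abs_self _
    _ ≤ C * ‖∑ i, (ε i * c.repr x i) • c i‖ := hφ _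
    _ ≤ C * (B * ‖x‖) := by
        refine mul_le_mul_of_nonneg_left (norm_sum_signs_le hc (fun i => ?_) x) hC
        simp only [hε]
        split_ifs <;> simp

end UnconditionalConstant

/-! ### Norm estimates in the James space -/

namespace JamesSpace

open James

theorem norm_le_of_variation_le {x : JamesSpace} {C : ℝ}
    (h : ∀ c : Chain, variation c x.coord ≤ √2 * C) : ‖x‖ ≤ C := by
  rw [norm_def, div_mul_eq_mul_div, one_mul, div_le_iff₀ (by positivity), mul_comm]
  exact ciSup_le h

theorem variation_le (x : JamesSpace) (c : Chain) : variation c x.coord ≤ √2 * ‖x‖ := by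
  rw [norm_def, ← mul_assoc, mul_one_div_cancel (by positivity), one_mul]
  exact le_ciSup x.bddAbove c

theorem sum_sq_le (x : JamesSpace) (c : Chain) :
    ∑ i : Fin (c.1 + 1), (x.coord (c.2.1 i) - x.coord (c.2.1 (i + 1))) ^ 2 ≤ 2 * ‖x‖ ^ 2 := by
  have h1 := x.variation_le c
  rw [variation, Real.sqrt_le_left (by positivity), mul_pow, Real.sq_sqrt (by norm_num)] at h1
  exact h1

/-- The sum of squared differences over disjoint intervals of indices. -/
theorem sum_sq_sub_le (x : JamesSpace) {q : ℕ} {ν : ℕ → ℕ}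
    (hν : ∀ k l, k < l → l < 2 * q → ν k < ν l) :
    ∑ l ∈ Finset.range q, (x.coord (ν (2 * l + 1)) - x.coord (ν (2 * l))) ^ 2 ≤ 2 * ‖x‖ ^ 2 := by
  rcases Nat.eq_zero_or_pos q with rfl | hq
  · simp
  set c : Chain := ⟨2 * q - 1, fun i => ν i, fun i j hij => hν i j hij (by omega)⟩ with hc
  have hdef : c.1 = 2 * q - 1 := rfl
  refine le_trans ?_ (x.sum_sq_le c)
  rw [← Fin.sum_univ_eq_sum_range
    (fun l => (x.coord (ν (2 * l + 1)) - x.coord (ν (2 * l))) ^ 2)]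
  have hinj : Function.Injective fun l : Fin q => (⟨2 * l, by omega⟩ : Fin (c.1 + 1)) := by
    intro a b hab
    simp only [Fin.mk.injEq] at hab
    exact Fin.ext (by omega)
  refine le_trans (le_of_eq ?_) (Finset.sum_le_univ_sum_of_nonneg
    (s := Finset.univ.map ⟨_, hinj⟩) fun i => sq_nonneg _)
  rw [Finset.sum_map]
  refine Finset.sum_congr rfl fun l _ => ?_
  have hsucc : (((⟨2 * l, by omega⟩ : Fin (c.1 + 1)) + 1 : Fin (c.1 + 1)) : ℕ) = 2 * l + 1 := by
    rw [Fin.val_add_one_of_lt]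
    rw [Fin.lt_def, Fin.val_last]
    simp only
    omega
  have e : ∀ i : Fin (c.1 + 1), c.2.1 i = ν i := fun i => rfl
  simp only [Function.Embedding.coeFn_mk, e, hsucc]
  ring

theorem abs_coord_sub_le (x : JamesSpace) {a b : ℕ} (hab : a < b) :
    |x.coord a - x.coord b| ≤ ‖x‖ := by
  have hmono : StrictMono (![a, b] : Fin 2 → ℕ) := by
    intro i j hij
    fin_cases i <;> fin_cases j <;> simp_all
  have h := x.sum_sq_le ⟨1, ![a, b], hmono⟩
  have h' : (x.coord a - x.coord b) ^ 2 + (x.coord b - x.coord a) ^ 2 ≤ 2 * ‖x‖ ^ 2 :=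
    (Fin.sum_univ_two fun i : Fin 2 =>
      (x.coord (![a, b] i) - x.coord (![a, b] (i + 1))) ^ 2).symm.trans_le h
  refine abs_le_of_sq_le_sq ?_ (norm_nonneg x)
  nlinarith

theorem abs_coord_le (x : JamesSpace) (a : ℕ) : |x.coord a| ≤ ‖x‖ := by
  have hlim : Filter.Tendsto x.coord Filter.atTop (nhds 0) := x.2.2
  have h1 : Filter.Tendsto (fun b => |x.coord a - x.coord b|) Filter.atTop
      (nhds |x.coord a - 0|) := (tendsto_const_nhds.sub hlim).abs
  rw [sub_zero] at h1
  refine le_of_tendsto h1 ?_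
  filter_upwards [Filter.eventually_gt_atTop a] with b hb
  exact x.abs_coord_sub_le hb

/-- A decreasing sequence with values in `[0, 1]` has cyclic total variation at most `2`, since
the differences other than the last one have constant sign and telescope. -/
theorem sum_abs_sub_le_two {u : ℕ → ℝ} (hu : Antitone u) (h0 : ∀ n, 0 ≤ u n) (h1 : ∀ n, u n ≤ 1)
    (c : Chain) : ∑ i : Fin (c.1 + 1), |u (c.2.1 i) - u (c.2.1 (i + 1))| ≤ 2 := by
  obtain ⟨m, p, hp⟩ := c
  have htel : ∑ i : Fin (m + 1), (u (p i) - u (p (i + 1))) = 0 := by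
    rw [Finset.sum_sub_distrib, sub_eq_zero]
    exact (Equiv.sum_comp (Equiv.addRight (1 : Fin (m + 1))) fun i => u (p i)).symm
  simp only
  rw [Fin.sum_univ_castSucc] at htel ⊢
  have hnn : ∀ i : Fin m, 0 ≤ u (p i.castSucc) - u (p (i.castSucc + 1)) := by
    intro i
    rw [Fin.coeSucc_eq_succ, sub_nonneg]
    exact hu (hp.monotone Fin.castSucc_lt_succ.le)
  rw [Finset.sum_congr rfl fun i _ => abs_of_nonneg (hnn i)]
  have hle : |u (p (Fin.last m)) - u (p (Fin.last m + 1))| ≤ 1 := by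
    rw [abs_le]
    constructor <;> linarith [h0 (p (Fin.last m)), h1 (p (Fin.last m)),
      h0 (p (Fin.last m + 1)), h1 (p (Fin.last m + 1))]
  have := neg_abs_le (u (p (Fin.last m)) - u (p (Fin.last m + 1)))
  linarith

/-- The `j`-th coordinate as a linear functional. -/
def coordLin (j : ℕ) : JamesSpace →ₗ[ℝ] ℝ where
  toFun x := x.coord j
  map_add' _ _ := rfl
  map_smul' _ _ := rfl

theorem coordLin_apply (j : ℕ) (x : JamesSpace) : coordLin j x = x.coord j := rfl

/-- The partial sum `e_0 + ⋯ + e_n`. -/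
def partialSum (n : ℕ) : JamesSpace := ∑ i ∈ Finset.range (n + 1), e i

theorem coord_partialSum (n j : ℕ) : (partialSum n).coord j = if j ≤ n then 1 else 0 := by
  have h : ∀ i, coordLin j (e i) = if i = j then 1 else 0 := by
    intro i
    have : coordLin j (e i) = (Pi.single i 1 : ℕ → ℝ) j := rfl
    rw [this, Pi.single_apply]
    simp only [eq_comm]
  rw [← coordLin_apply, partialSum, map_sum, Finset.sum_congr rfl fun i _ => h i,
    Finset.sum_ite_eq']
  simp

theorem antitone_coord_partialSum (n : ℕ) : Antitone (partialSum n).coord := by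
  intro a b hab
  simp only [coord_partialSum]
  split_ifs <;> first | omega | norm_num

theorem coord_partialSum_mem (n j : ℕ) :
    0 ≤ (partialSum n).coord j ∧ (partialSum n).coord j ≤ 1 := by
  rw [coord_partialSum]
  split_ifs <;> norm_num

theorem coord_partialSum_mono {m n : ℕ} (h : m ≤ n) (j : ℕ) :
    (partialSum m).coord j ≤ (partialSum n).coord j := by
  simp only [coord_partialSum]
  split_ifs <;> first | omega | norm_num

theorem norm_partialSum_le (n : ℕ) : ‖partialSum n‖ ≤ 1 := by
  refine norm_le_of_variation_le fun c => ?_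
  rw [mul_one, variation]
  refine Real.sqrt_le_sqrt ?_
  refine le_trans (Finset.sum_le_sum fun i _ => ?_) (sum_abs_sub_le_two
    (antitone_coord_partialSum n) (fun j => (coord_partialSum_mem n j).1)
    (fun j => (coord_partialSum_mem n j).2) c)
  rw [← sq_abs]
  have h1 := coord_partialSum_mem n (c.2.1 i)
  have h2 := coord_partialSum_mem n (c.2.1 (i + 1))
  have : |(partialSum n).coord (c.2.1 i) - (partialSum n).coord (c.2.1 (i + 1))| ≤ 1 :=
    abs_le.2 ⟨by linarith, by linarith⟩
  nlinarith [abs_nonneg ((partialSum n).coord (c.2.1 i) - (partialSum n).coord (c.2.1 (i + 1)))]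

/-- A signed sum of differences of partial sums over `q` disjoint intervals has values in
`[-1, 1]` and cyclic total variation at most `4 q`. -/
theorem norm_sum_sub_partialSum_le {q : ℕ} {ν : ℕ → ℕ}
    (hν : ∀ k l, k < l → l < 2 * q → ν k < ν l) {ε : ℕ → ℝ} (hε : ∀ l, ε l = 1 ∨ ε l = -1) :
    ‖∑ l ∈ Finset.range q, ε l • (partialSum (ν (2 * l + 1)) - partialSum (ν (2 * l)))‖ ≤
      2 * √q := by
  have hεabs : ∀ l, |ε l| = 1 := fun l => by rcases hε l with h | h <;> simp [h]
  set x := ∑ l ∈ Finset.range q, ε l • (partialSum (ν (2 * l + 1)) - partialSum (ν (2 * l)))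
    with hx
  set u : ℕ → ℕ → ℝ := fun k j => (partialSum (ν k)).coord j with hu
  have hcoord : ∀ j, x.coord j = ∑ l ∈ Finset.range q, ε l * (u (2 * l + 1) j - u (2 * l) j) := by
    intro j
    rw [← coordLin_apply, hx, map_sum]
    refine Finset.sum_congr rfl fun l _ => ?_
    rw [map_smul, map_sub, smul_eq_mul, coordLin_apply, coordLin_apply]
  have hmono : ∀ k l j, k < l → l < 2 * q → u k j ≤ u l j := fun k l j hkl hl =>
    coord_partialSum_mono (hν k l hkl hl).le j
  -- the sum telescopes, because `u k j` increases with `k`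
  have htel : ∀ j, ∀ r ≤ q, r = 0 ∨
      ∑ l ∈ Finset.range r, (u (2 * l + 1) j - u (2 * l) j) ≤ u (2 * r - 1) j := by
    intro j r
    induction r with
    | zero => intro _; exact Or.inl rfl
    | succ r ih =>
      intro hr
      refine Or.inr ?_
      rw [Finset.sum_range_succ, show 2 * (r + 1) - 1 = 2 * r + 1 by omega]
      rcases ih (by omega) with rfl | h
      · have := (coord_partialSum_mem (ν (2 * 0)) j).1
        simp only [Finset.range_zero, Finset.sum_empty, zero_add]
        linarith
      · rcases Nat.eq_zero_or_pos r with rfl | hr0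
        · have := (coord_partialSum_mem (ν (2 * 0)) j).1
          simp only [Finset.range_zero, Finset.sum_empty, zero_add]
          linarith
        · have := hmono (2 * r - 1) (2 * r) j (by omega) (by omega)
          linarith
  have hsup : ∀ j, |x.coord j| ≤ 1 := by
    intro j
    rw [hcoord]
    refine (Finset.abs_sum_le_sum_abs _ _).trans ?_
    have : ∀ l ∈ Finset.range q, |ε l * (u (2 * l + 1) j - u (2 * l) j)| =
        u (2 * l + 1) j - u (2 * l) j := by
      intro l hl
      have := Finset.mem_range.1 hl
      rw [abs_mul, hεabs, one_mul, abs_of_nonneg]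
      rw [sub_nonneg]
      exact hmono _ _ j (by omega) (by omega)
    rw [Finset.sum_congr rfl this]
    rcases htel j q le_rfl with rfl | h
    · simp
    · exact h.trans (coord_partialSum_mem _ j).2
  refine norm_le_of_variation_le fun c => ?_
  have htv : ∑ i : Fin (c.1 + 1), |x.coord (c.2.1 i) - x.coord (c.2.1 (i + 1))| ≤ 4 * q := by
    calc ∑ i : Fin (c.1 + 1), |x.coord (c.2.1 i) - x.coord (c.2.1 (i + 1))|
        ≤ ∑ i : Fin (c.1 + 1), ∑ l ∈ Finset.range q,
          (|u (2 * l + 1) (c.2.1 i) - u (2 * l + 1) (c.2.1 (i + 1))| +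
            |u (2 * l) (c.2.1 i) - u (2 * l) (c.2.1 (i + 1))|) := by
          refine Finset.sum_le_sum fun i _ => ?_
          rw [hcoord, hcoord, ← Finset.sum_sub_distrib]
          refine (Finset.abs_sum_le_sum_abs _ _).trans (Finset.sum_le_sum fun l _ => ?_)
          rw [← mul_sub, abs_mul, hεabs, one_mul, sub_sub_sub_comm]
          exact abs_sub _ _
      _ = ∑ l ∈ Finset.range q,
          (∑ i : Fin (c.1 + 1), |u (2 * l + 1) (c.2.1 i) - u (2 * l + 1) (c.2.1 (i + 1))| +
            ∑ i : Fin (c.1 + 1), |u (2 * l) (c.2.1 i) - u (2 * l) (c.2.1 (i + 1))|) := by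
          rw [Finset.sum_comm]
          exact Finset.sum_congr rfl fun l _ => Finset.sum_add_distrib
      _ ≤ ∑ l ∈ Finset.range q, (2 + 2 : ℝ) := by
          refine Finset.sum_le_sum fun l _ => add_le_add ?_ ?_ <;>
          exact sum_abs_sub_le_two (antitone_coord_partialSum _)
            (fun j => (coord_partialSum_mem _ j).1) (fun j => (coord_partialSum_mem _ j).2) c
      _ = 4 * q := by rw [Finset.sum_const, Finset.card_range, nsmul_eq_mul]; ring
  rw [variation, Real.sqrt_le_left (by positivity), mul_pow, mul_pow, Real.sq_sqrt (by norm_num),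
    Real.sq_sqrt (Nat.cast_nonneg q)]
  calc ∑ i : Fin (c.1 + 1), (x.coord (c.2.1 i) - x.coord (c.2.1 (i + 1))) ^ 2
      ≤ ∑ i : Fin (c.1 + 1), 2 * |x.coord (c.2.1 i) - x.coord (c.2.1 (i + 1))| := by
        refine Finset.sum_le_sum fun i _ => ?_
        rw [← sq_abs, sq]
        refine mul_le_mul_of_nonneg_right ?_ (abs_nonneg _)
        have := abs_sub (x.coord (c.2.1 i)) (x.coord (c.2.1 (i + 1)))
        linarith [hsup (c.2.1 i), hsup (c.2.1 (i + 1))]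
    _ ≤ 2 * (2 ^ 2 * q) := by
        rw [← Finset.mul_sum]
        linarith

/-- A signed sum of differences of coordinate functionals over `q` disjoint intervals has norm
at most `2 √q`. -/
theorem abs_sum_sub_coord_le (x : JamesSpace) {q : ℕ} {ν : ℕ → ℕ}
    (hν : ∀ k l, k < l → l < 2 * q → ν k < ν l) {ε : ℕ → ℝ} (hε : ∀ l, ε l = 1 ∨ ε l = -1) :
    |∑ l ∈ Finset.range q, ε l * (x.coord (ν (2 * l + 1)) - x.coord (ν (2 * l)))| ≤
      2 * √q * ‖x‖ := by
  refine abs_le_of_sq_le_sq ?_ (by positivity)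
  have h1 := Finset.sum_mul_sq_le_sq_mul_sq (Finset.range q) ε
    fun l => x.coord (ν (2 * l + 1)) - x.coord (ν (2 * l))
  have h2 : ∑ l ∈ Finset.range q, ε l ^ 2 = q := by
    rw [Finset.sum_congr rfl fun l _ => show ε l ^ 2 = 1 by rcases hε l with h | h <;> simp [h]]
    simp
  rw [h2] at h1
  refine h1.trans ?_
  rw [mul_pow, mul_pow, Real.sq_sqrt (Nat.cast_nonneg q)]
  have := mul_le_mul_of_nonneg_left (x.sum_sq_sub_le hν) (Nat.cast_nonneg (α := ℝ) q)
  have h3 : 0 ≤ (q : ℝ) * ‖x‖ ^ 2 := by positivity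
  linarith

/-! ### The coordinates of the James space in an unconditional basis -/

theorem partialSum_mem_initial {n K : ℕ} (h : n ≤ K) : partialSum n ∈ initial K :=
  Submodule.sum_mem _ fun i hi => Submodule.subset_span
    ⟨i, (Nat.lt_succ_iff.1 (Finset.mem_range.1 hi)).trans h, rfl⟩

/-- The partial sum `e_0 + ⋯ + e_n` as an element of `J_K`, with `n` capped at `K`. -/
def initialSum (K n : ℕ) : initial K :=
  ⟨partialSum (min n K), partialSum_mem_initial (min_le_right _ _)⟩

/-- The `n`-th coordinate as a linear functional on `J_K`. -/
def initialCoord (K n : ℕ) : initial K →ₗ[ℝ] ℝ := (coordLin n).comp (initial K).subtype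

variable {ι : Type*} [Fintype ι] {K : ℕ}

/-- The `n`-th partial sum, expanded in the basis `c`, together with the values of the `n`-th
coordinate functional on `c`. -/
noncomputable def coordPair (c : Module.Basis ι ℝ (initial K)) (n : ℕ) : ι ⊕ ι → ℝ :=
  Sum.elim (fun i => c.repr (initialSum K n) i) fun i => initialCoord K n (c i)

theorem sum_coordPair (c : Module.Basis ι ℝ (initial K)) {n : ℕ} (hn : n ≤ K) (j : ℕ) :
    ∑ i, coordPair c n (Sum.inl i) * coordPair c j (Sum.inr i) = if j ≤ n then 1 else 0 := by
  have h1 : initialCoord K j (initialSum K n) = if j ≤ n then 1 else 0 := by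
    have : initialCoord K j (initialSum K n) = (partialSum (min n K)).coord j := rfl
    rw [this, coord_partialSum, min_eq_left hn]
  rw [← h1]
  conv_rhs => rw [← c.sum_repr (initialSum K n), map_sum]
  exact Finset.sum_congr rfl fun i _ => by simp [coordPair]

theorem abs_initialCoord_le (n : ℕ) (x : initial K) : |initialCoord K n x| ≤ 1 * ‖x‖ := by
  rw [one_mul]
  exact abs_coord_le x.1 n

theorem norm_initialSum_le (n : ℕ) : ‖initialSum K n‖ ≤ 1 := norm_partialSum_le _

theorem isTame_coordPair {c : Module.Basis ι ℝ (initial K)} {B D : ℝ} (hB : 0 ≤ B)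
    (hc : unconditionalConstant c ≤ (B : EReal)) (hD : 4 * B ≤ D) :
    IsTame D (K + 1) (coordPair c) := by
  have hpair : ∀ j k, ∑ i, |initialCoord K j (c i)| * |c.repr (initialSum K k) i| ≤ B := by
    intro j k
    refine (sum_abs_repr_mul_le hc _ _ zero_le_one (abs_initialCoord_le j)).trans ?_
    have := mul_le_mul_of_nonneg_left (norm_initialSum_le (K := K) k) hB
    linarith
  constructor
  · intro j _ k _
    rw [Fintype.sum_sum_type]
    simp only [coordPair, Sum.swap_inl, Sum.swap_inr, Sum.elim_inl, Sum.elim_inr]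
    have h1 := hpair j k
    have h2 := hpair k j
    simp only [mul_comm |initialCoord K k _|] at h2
    linarith
  · intro j _ q ν hνK hν σ hσ
    rw [Fintype.sum_sum_type]
    simp only [coordPair, Sum.swap_inl, Sum.swap_inr, Sum.elim_inl, Sum.elim_inr]
    have hleft : ∑ i, |initialCoord K j (c i)| *
        |c.repr (initialSum K (ν (2 * σ (Sum.inl i) + 1))) i -
          c.repr (initialSum K (ν (2 * σ (Sum.inl i)))) i| ≤ B * (2 * √q) := by
      obtain ⟨ε, hε, hle⟩ := exists_signs_selector
        (w := fun i => |initialCoord K j (c i)|) (fun i => abs_nonneg _)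
        (fun l i => c.repr (initialSum K (ν (2 * l + 1))) i - c.repr (initialSum K (ν (2 * l))) i)
        (σ := fun i => σ (Sum.inl i)) (fun i => hσ _)
      refine hle.trans ?_
      set x := ∑ l ∈ Finset.range q,
        ε l • (initialSum K (ν (2 * l + 1)) - initialSum K (ν (2 * l))) with hx
      have hrepr : ∀ i, c.repr x i = ∑ l ∈ Finset.range q, ε l *
          (c.repr (initialSum K (ν (2 * l + 1))) i - c.repr (initialSum K (ν (2 * l))) i) := by
        intro i
        simp [hx]
      have hnorm : ‖x‖ ≤ 2 * √q := by
        refine le_trans (le_of_eq ?_) (norm_sum_sub_partialSum_le hν hε)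
        change ‖(x : JamesSpace)‖ = _
        rw [hx, Submodule.coe_sum]
        congr 1
        refine Finset.sum_congr rfl fun l hl => ?_
        have hl := Finset.mem_range.1 hl
        have h1 : ν (2 * l) ≤ K := Nat.lt_succ_iff.1 (hνK _ (by omega))
        have h2 : ν (2 * l + 1) ≤ K := Nat.lt_succ_iff.1 (hνK _ (by omega))
        simp [initialSum, h1, h2]
      simp only [← hrepr]
      refine (sum_abs_repr_mul_le hc _ _ zero_le_one (abs_initialCoord_le j)).trans ?_
      rw [one_mul]
      exact mul_le_mul_of_nonneg_left hnorm hB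
    have hright : ∑ i, |c.repr (initialSum K j) i| *
        |initialCoord K (ν (2 * σ (Sum.inr i) + 1)) (c i) -
          initialCoord K (ν (2 * σ (Sum.inr i))) (c i)| ≤ B * (2 * √q) := by
      obtain ⟨ε, hε, hle⟩ := exists_signs_selector
        (w := fun i => |c.repr (initialSum K j) i|) (fun i => abs_nonneg _)
        (fun l i => initialCoord K (ν (2 * l + 1)) (c i) - initialCoord K (ν (2 * l)) (c i))
        (σ := fun i => σ (Sum.inr i)) (fun i => hσ _)
      refine hle.trans ?_
      set φ : initial K →ₗ[ℝ] ℝ := ∑ l ∈ Finset.range q,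
        ε l • (initialCoord K (ν (2 * l + 1)) - initialCoord K (ν (2 * l))) with hφ
      have happ : ∀ x, φ x = ∑ l ∈ Finset.range q, ε l *
          (initialCoord K (ν (2 * l + 1)) x - initialCoord K (ν (2 * l)) x) := by
        intro x
        simp [hφ, LinearMap.sum_apply]
      simp only [← happ]
      simp only [mul_comm |c.repr (initialSum K j) _|]
      refine (sum_abs_repr_mul_le hc _ φ (C := 2 * √q) (by positivity) fun x => ?_).trans ?_
      · rw [happ]
        exact abs_sum_sub_coord_le x.1 hν hε
      · have h1 := mul_le_mul_of_nonneg_left (norm_initialSum_le (K := K) j) hB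
        have h2 := mul_le_mul_of_nonneg_left h1 (show (0 : ℝ) ≤ 2 * √q by positivity)
        linarith
    have : 4 * B * √q ≤ D * √q := mul_le_mul_of_nonneg_right hD (Real.sqrt_nonneg _)
    linarith

instance (K : ℕ) : Nontrivial (initial K) := by
  refine ⟨initialSum K 0, 0, fun h => ?_⟩
  have h1 : (partialSum (min 0 K)).coord 0 = 0 := by
    have := congrArg (initialCoord K 0) h
    rwa [map_zero] at this
  rw [coord_partialSum] at h1
  simp at h1

end JamesSpace

/-! ### Growth rates -/

theorem le_fastGrowing (m n : ℕ) : n ≤ fastGrowing m n := by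
  induction m generalizing n with
  | zero => exact Nat.le_succ n
  | succ m ih => exact Function.id_le_iterate_of_id_le ih n n

theorem fastGrowing_le_succ (m : ℕ) {n : ℕ} (hn : 0 < n) :
    fastGrowing m n ≤ fastGrowing (m + 1) n := by
  obtain ⟨k, rfl⟩ := Nat.exists_eq_succ_of_ne_zero hn.ne'
  change _ ≤ (fastGrowing m)^[k + 1] (k + 1)
  rw [Function.iterate_succ_apply]
  exact Function.id_le_iterate_of_id_le (le_fastGrowing m) k _

theorem fastGrowing_mono_left {m m' n : ℕ} (hn : 0 < n) (h : m ≤ m') :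
    fastGrowing m n ≤ fastGrowing m' n := by
  induction m', h using Nat.le_induction with
  | base => exact le_rfl
  | succ m' _ ih => exact ih.trans (fastGrowing_le_succ m' hn)

theorem two_pow_le_fastGrowing_two {n : ℕ} (hn : 0 < n) : 2 ^ n ≤ fastGrowing 2 n := by
  have h1 : fastGrowing 1 = fun k => 2 * k := by
    funext k
    change (fun k => k + 1)^[k] k = _
    have : ∀ a b : ℕ, (fun k => k + 1)^[a] b = b + a := by
      intro a
      induction a with
      | zero => intro b; rfl
      | succ a ih => intro b; rw [Function.iterate_succ_apply, ih]; ring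
    rw [this]; ring
  have h2 : ∀ a b : ℕ, (fun k => 2 * k)^[a] b = 2 ^ a * b := by
    intro a
    induction a with
    | zero => intro b; simp
    | succ a ih => intro b; rw [Function.iterate_succ_apply, ih]; ring
  change _ ≤ (fastGrowing 1)^[n] n
  rw [h1, h2]
  exact Nat.le_mul_of_pos_right _ hn

theorem two_pow_two_pow_two_pow_le {n : ℕ} (hn : 3 ≤ n) :
    2 ^ 2 ^ 2 ^ n ≤ fastGrowingOmega n := by
  refine le_trans ?_ (fastGrowing_mono_left (by omega) hn)
  obtain ⟨k, rfl⟩ := Nat.exists_eq_add_of_le' hn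
  change _ ≤ (fastGrowing 2)^[k + 3] (k + 3)
  rw [Function.iterate_add_apply]
  refine le_trans ?_ (Function.id_le_iterate_of_id_le (le_fastGrowing 2) k _)
  change _ ≤ fastGrowing 2 (fastGrowing 2 (fastGrowing 2 (k + 3)))
  have step : ∀ a b : ℕ, 0 < b → a ≤ b → 2 ^ a ≤ fastGrowing 2 b := fun a b hb hab =>
    (Nat.pow_le_pow_right two_pos hab).trans (two_pow_le_fastGrowing_two hb)
  have hpos : ∀ b, 0 < b → 0 < fastGrowing 2 b := fun b hb => hb.trans_le (le_fastGrowing 2 b)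
  have h0 : 0 < k + 3 := by omega
  exact step _ _ (hpos _ (hpos _ h0)) (step _ _ (hpos _ h0) (step _ _ h0 le_rfl))

theorem stageLength_le {R : ℕ} (hR : 0 < R) (m : ℕ) : stageLength R m ≤ 2 ^ (2 * R) ^ m := by
  induction m with
  | zero => simp [stageLength]
  | succ m ih =>
    have hpos : 0 < (2 * R) ^ m * R := by positivity
    calc stageLength R (m + 1) = stageLength R m ^ R + 1 := rfl
      _ ≤ (2 ^ (2 * R) ^ m) ^ R + 1 := by gcongr
      _ ≤ 2 ^ ((2 * R) ^ m * R) + 2 ^ ((2 * R) ^ m * R) := by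
          rw [← pow_mul]
          have : 1 ≤ 2 ^ ((2 * R) ^ m * R) := Nat.one_le_two_pow
          omega
      _ = 2 ^ ((2 * R) ^ m * R + 1) := by rw [pow_succ]; ring
      _ ≤ 2 ^ (2 * R) ^ (m + 1) := by
          refine Nat.pow_le_pow_right two_pos ?_
          rw [pow_succ]
          nlinarith

theorem pow_five_le_two_pow {n : ℕ} (hn : 31 ≤ n) : n ^ 5 ≤ 2 ^ n := by
  induction n, hn using Nat.le_induction with
  | base => norm_num
  | succ n hn ih =>
    have h1 : (n + 1) ^ 5 ≤ 2 * n ^ 5 := by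
      have h0 : 1 ≤ n := by omega
      have e1 : n ^ 3 ≤ n ^ 4 := Nat.pow_le_pow_right h0 (by norm_num)
      have e2 : n ^ 2 ≤ n ^ 4 := Nat.pow_le_pow_right h0 (by norm_num)
      have e3 : n ^ 1 ≤ n ^ 4 := Nat.pow_le_pow_right h0 (by norm_num)
      have e4 : n ^ 0 ≤ n ^ 4 := Nat.pow_le_pow_right h0 (by norm_num)
      have e5 : 31 * n ^ 4 ≤ n ^ 5 := by rw [pow_succ' n 4]; exact Nat.mul_le_mul_right _ hn
      have e6 : (n + 1) ^ 5 = n ^ 5 + 5 * n ^ 4 + 10 * n ^ 3 + 10 * n ^ 2 + 5 * n ^ 1 + n ^ 0 := by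
        ring
      omega
    rw [pow_succ 2]
    omega

theorem stageLength_le_fastGrowingOmega {n : ℕ} (hn : 164 ≤ n) :
    stageLength (n ^ 40) (4 * n ^ 3) ≤ fastGrowingOmega n := by
  refine (stageLength_le (by positivity) _).trans
    (le_trans ?_ (two_pow_two_pow_two_pow_le (by omega)))
  refine Nat.pow_le_pow_right two_pos ?_
  calc (2 * n ^ 40) ^ (4 * n ^ 3) ≤ (n ^ 41) ^ (4 * n ^ 3) := by
        refine Nat.pow_le_pow_left ?_ _
        rw [pow_succ' n 40]
        exact Nat.mul_le_mul_right _ (by omega)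
    _ ≤ ((2 ^ n) ^ 41) ^ (4 * n ^ 3) := by
        refine Nat.pow_le_pow_left (Nat.pow_le_pow_left Nat.lt_two_pow_self.le _) _
    _ = 2 ^ (164 * n ^ 4) := by rw [← pow_mul, ← pow_mul]; congr 1; ring
    _ ≤ 2 ^ 2 ^ n := by
        refine Nat.pow_le_pow_right two_pos (le_trans ?_ (pow_five_le_two_pow (by omega)))
        rw [pow_succ' n 4]
        exact Nat.mul_le_mul_right _ hn

/-! ### Lower bounds for unconditional constants -/

/-- The parameters are powers of `n`: a sequence of `4 n³ + 1` terms, stable up to `n⁻⁵`, where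
truncations have energy at most `n¹⁴` and each failure to stabilize gains `n⁻²⁵`, so that `n⁴⁰`
rounds suffice for one stabilization. -/
theorem IsTame.false_of_fastGrowingOmega_le {ι : Type*} [Fintype ι] {K n : ℕ} (hn : 600 ≤ n)
    (hK : fastGrowingOmega n ≤ K) {x : ℕ → ι ⊕ ι → ℝ} (hx : IsTame n (K + 1) x)
    (hbi : ∀ k ≤ K, ∀ j ≤ K, ∑ i, x k (Sum.inl i) * x j (Sum.inr i) = if j ≤ k then 1 else 0) :
    False := by
  have hnR : (600 : ℝ) ≤ n := by exact_mod_cast hn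
  have hn0 : (0 : ℝ) < n := by linarith
  have hpow : ∀ a b : ℕ, a ≤ b → (n : ℝ) ^ a ≤ (n : ℝ) ^ b := fun a b h =>
    pow_le_pow_right₀ (by linarith) h
  have hmul : ∀ a b : ℕ, a + 1 = b → 600 * (n : ℝ) ^ a ≤ (n : ℝ) ^ b := by
    rintro a _ rfl
    rw [pow_succ']
    exact mul_le_mul_of_nonneg_right hnR (by positivity)
  have hp0 : ∀ a : ℕ, 0 < (n : ℝ) ^ a := fun a => by positivity
  obtain ⟨J, y, hJ, hJm, hy, hstab⟩ := IsTame.exists_stable (ι := ι) (D := n)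
    (ε := 1 / (n : ℝ) ^ 5) (Λ := (n : ℝ) ^ 14) (η := 1 / (n : ℝ) ^ 25) (R := n ^ 40)
    hn0.le (by positivity)
    (by
      have h1 : (n : ℝ) / (1 / (n : ℝ) ^ 5 / 4) = 4 * (n : ℝ) ^ 6 := by field_simp
      rw [h1]
      have h2 : (2 * (4 * (n : ℝ) ^ 6) ^ 2 + 1) * n = 32 * (n : ℝ) ^ 13 + (n : ℝ) ^ 1 := by ring
      rw [h2]
      have := hpow 1 13 (by norm_num)
      have := hmul 13 14 rfl
      linarith [hp0 13])
    (by
      have h1 : 4 * (1 / (n : ℝ) ^ 25) * (n : ℝ) ^ 14 = 4 / (n : ℝ) ^ 11 := by field_simp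
      have h2 : (1 / (n : ℝ) ^ 5 / 2) ^ 2 = 1 / (4 * (n : ℝ) ^ 10) := by
        rw [div_pow, div_pow, ← pow_mul, div_div]; norm_num; ring
      rw [h1, h2, div_le_div_iff₀ (hp0 _) (by positivity)]
      have := hmul 10 11 rfl
      linarith [hp0 10])
    (by
      have h1 : ((n ^ 40 : ℕ) : ℝ) * (1 / (n : ℝ) ^ 25) = (n : ℝ) ^ 15 := by
        push_cast; field_simp
      rw [h1]
      have := hmul 14 15 rfl
      linarith [hp0 14])
    (by positivity) (4 * n ^ 3) (K + 1) x hx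
    ((stageLength_le_fastGrowingOmega (by omega)).trans (by omega))
  -- the biorthogonality relations are bilinear, hence pass to block convex combinations
  have hbil : ∀ r < 4 * n ^ 3 + 1, ∀ s < 4 * n ^ 3 + 1, ∀ C : ℝ,
      (∀ a ∈ J r, ∀ b ∈ J s, ∑ i, x a (Sum.inl i) * x b (Sum.inr i) = C) →
      ∑ i, y r (Sum.inl i) * y s (Sum.inr i) = C := by
    intro r hr s hs C hC
    have hconv : ∀ φ : (ι ⊕ ι → ℝ) →ₗ[ℝ] ℝ, Convex ℝ {z | φ z = C} := fun φ =>
      (convex_singleton C).linear_preimage φ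
    have h1 : ∀ b ∈ J s, ∑ i, y r (Sum.inl i) * x b (Sum.inr i) = C := by
      intro b hb
      let φ : (ι ⊕ ι → ℝ) →ₗ[ℝ] ℝ := ∑ i, x b (Sum.inr i) • LinearMap.proj (Sum.inl i)
      have hφ : ∀ z, φ z = ∑ i, z (Sum.inl i) * x b (Sum.inr i) := fun z => by
        simp [φ, LinearMap.sum_apply, mul_comm]
      have := convexHull_min (s := x '' J r) (t := {z | φ z = C})
        (by rintro _ ⟨a, ha, rfl⟩; exact (hφ _).trans (hC a ha b hb)) (hconv φ) (hy r hr)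
      exact (hφ _).symm.trans this
    let φ : (ι ⊕ ι → ℝ) →ₗ[ℝ] ℝ := ∑ i, y r (Sum.inl i) • LinearMap.proj (Sum.inr i)
    have hφ : ∀ z, φ z = ∑ i, y r (Sum.inl i) * z (Sum.inr i) := fun z => by
      simp [φ, LinearMap.sum_apply]
    have := convexHull_min (s := x '' J s) (t := {z | φ z = C})
      (by rintro _ ⟨b, hb, rfl⟩; exact (hφ _).trans (h1 b hb)) (hconv φ) (hy s hs)
    exact (hφ _).symm.trans this
  refine (hx.of_convexHull hJ hJm hy).false_of_stable (q := n ^ 3) hstab ?_ ?_ (by positivity)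
    ?_ ?_
  · intro r s hrs hs
    refine hbil r (by omega) s hs 0 fun a ha b hb => ?_
    have := hJm r s hrs hs a ha b hb
    have hb' := hJ s hs b hb
    rw [hbi a (by omega) b (by omega), if_neg (by omega)]
  · intro r s hrs hs
    refine hbil s hs r (by omega) 1 fun a ha b hb => ?_
    have := hJm r s hrs hs b hb a ha
    have ha' := hJ s hs a ha
    rw [hbi a (by omega) b (by omega), if_pos (by omega)]
  · refine Real.le_sqrt_of_sq_le ?_
    push_cast
    have := hmul 2 3 rfl
    nlinarith [hp0 2]
  · push_cast
    rw [mul_one_div, div_le_iff₀ (hp0 5)]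
    have e1 := hmul 3 4 rfl
    have e2 := hmul 4 5 rfl
    have e3 := hpow 0 3 (by norm_num)
    rw [pow_zero] at e3
    linarith [hp0 3]

theorem lt_unconditionalConstant_initial {ι : Type*} [Fintype ι] {B : ℝ} {K : ℕ}
    (hK : fastGrowingOmega ⌈2 ^ 29 * B ^ 4 + 5⌉₊ ≤ K)
    (c : Module.Basis ι ℝ (JamesSpace.initial K)) : (B : EReal) < unconditionalConstant c := by
  rcases lt_or_ge B 1 with hB | hB
  · refine lt_of_lt_of_le ?_ (one_le_unconditionalConstant c)
    exact_mod_cast hB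
  by_contra hcon
  set n := ⌈2 ^ 29 * B ^ 4 + 5⌉₊ with hn
  have h1 : 2 ^ 29 * B ^ 4 + 5 ≤ (n : ℝ) := Nat.le_ceil _
  have h2 : B ≤ B ^ 4 := le_self_pow₀ hB (by norm_num)
  have h3 : (600 : ℝ) ≤ n := by linarith
  exact IsTame.false_of_fastGrowingOmega_le (by exact_mod_cast h3) hK
    (JamesSpace.isTame_coordPair (by linarith) (not_lt.1 hcon) (by linarith))
    fun k hk j _ => JamesSpace.sum_coordPair c hk j

theorem mainTheorem1 :
    (∀ (B : ℝ) (K : ℕ), fastGrowingOmega ⌈2 ^ 29 * B ^ 4 + 5⌉₊ ≤ K →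
      ∀ (ι : Type*) [Fintype ι] (c : Module.Basis ι ℝ (JamesSpace.initial K)),
        (B : EReal) < unconditionalConstant c) ∧
    ¬ HasLocalUnconditionalStructure JamesSpace := by
  refine ⟨fun B K hK ι _ c => lt_unconditionalConstant_initial hK c, ?_⟩
  rintro ⟨B, hB⟩
  obtain ⟨n, c, hc⟩ := hB (JamesSpace.initial (fastGrowingOmega ⌈2 ^ 29 * B ^ 4 + 5⌉₊))
    (Submodule.fg_span ((Set.finite_Iic _).image _))
  exact absurd (lt_unconditionalConstant_initial le_rfl c) (not_lt.2 hc)
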